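/- Let $d\ge 2$ and let $\mathbb H^d=\{x\in\mathbb R^{d+1} : \langle x,x\rangle_-=-1,\ x_{d+1}>0\}$ be hyperbolic space, where $\langle x,y\rangle_-=x_1y_1+\dots+x_dy_d-x_{d+1}y_{d+1}$, with its hyperbolic distance $d_{\mathbb H^d}$, volume measure $\mathrm d\mathbb H^d$ and Laplace–Beltrami operator $\Delta$. For $\rho>0$ put $$k(\rho)=\frac{\cosh\rho}{v_{d-1}}\int_{+\infty}^{\rho}\frac{\mathrm dt}{\sinh^{d-1}(t)\cosh^2(t)},$$ where $v_{d-1}$ is the area of the unit sphere of $\mathbb R^d$, and let $G(x,y)=k(d_{\mathbb H^d}(x,y))$ for $x\neq y$. For $f\in\mathcal D(\mathbb H^d)=C_c^\infty(\mathbb H^d)$ (real-valued) put $$h_f(x)=d\int_{\mathbb H^d}G(x,y)f(y)\,\mathrm d\mathbb H^d(y).$$ Let $\mu$ be a (positive) Radon measure on $\mathbb H^d$, i.e. a Borel measure that is finite on compact sets, such that for some $x_0\in\mathbb H^d$ $$\int_{\{y\,:\,d_{\mathbb H^d}(x_0,y)\ge 1\}}|G(x_0,y)|\,\mathrm d\mu(y)<+\infty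 .$$ Then for every $f\in\mathcal D(\mathbb H^d)$ the integral defining $h_f(x)$ converges absolutely for every $x\in\mathbb H^d$, and $h_f$ is $\mu$-integrable. The formal expression $h_\mu=d\int_{\mathbb H^d}G(\cdot,y)\,\mathrm d\mu(y)$ defines a distribution $h_\mu\in\mathcal D'(\mathbb H^d)$, that is, a continuous linear functional on $\mathcal D(\mathbb H^d)$, whose action is $$(h_\mu,f):=(\mu,h_f)=\int_{\mathbb H^d}h_f(x)\,\mathrm d\mu(x),\qquad f\in\mathcal D(\mathbb H^d).$$ It solves $\frac1d\Delta h_\mu-h_\mu=\mu$ in the sense of distributions on $\mathbb H^d$: $$\Bigl(h_\mu,\tfrac1d\Delta f-f\Bigr)=\int_{\mathbb H^d}f\,\mathrm d\mu\qquad\text{for all } f\in\mathcal D(\mathbb H^d).$$ -/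

import Mathlib

open MeasureTheory
open scoped ContDiff Distributions

noncomputable section

namespace Hyperbolic

/-- Coordinate space `ℝ^d`. -/
abbrev Coord (d : ℕ) : Type := EuclideanSpace ℝ (Fin d)

/-- The vector space `ℝ^{d+1}` underlying Minkowski space. -/
abbrev Mink (d : ℕ) : Type := EuclideanSpace ℝ (Fin (d + 1))

/-- The Minkowski form `x₁y₁ + ⋯ + x_d y_d - x_{d+1} y_{d+1}`. -/
def mink {d : ℕ} (x y : Mink d) : ℝ :=
  ∑ i : Fin d, x i.castSucc * y i.castSucc - x (Fin.last d) * y (Fin.last d)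

/-- Hyperbolic space `H^d` as the future pseudo-sphere
`{x | ⟨x, x⟩ = -1, x_{d+1} > 0}` of Minkowski space. It carries the subspace topology and its
Borel σ-algebra; its distance is `hdist` below, not the distance inherited from `ℝ^{d+1}`. -/
abbrev Hyp (d : ℕ) : Type := {x : Mink d // mink x x = -1 ∧ 0 < x (Fin.last d)}

/-- The hyperbolic distance, given by `cosh (hdist x y) = -⟨x, y⟩`. -/
def hdist {d : ℕ} (x y : Hyp d) : ℝ := Real.arcosh (-mink x.1 y.1)

/-! ### The global parametrization `u ↦ (u, √(1 + |u|²))` of the hyperboloid -/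

/-- The parametrization, as a map into `ℝ^{d+1}`. -/
def emb {d : ℕ} (u : Coord d) : Mink d :=
  WithLp.toLp 2 (Fin.snoc (α := fun _ => ℝ) (fun i => u i) (Real.sqrt (1 + ‖u‖ ^ 2)))

@[simp] lemma emb_castSucc {d : ℕ} (u : Coord d) (i : Fin d) : emb u i.castSucc = u i := by
  simp [emb]

@[simp] lemma emb_last {d : ℕ} (u : Coord d) :
    emb u (Fin.last d) = Real.sqrt (1 + ‖u‖ ^ 2) := by
  simp [emb]

lemma emb_mem {d : ℕ} (u : Coord d) :
    mink (emb u) (emb u) = -1 ∧ 0 < emb u (Fin.last d) := by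
  have h : (0 : ℝ) < 1 + ‖u‖ ^ 2 := by positivity
  refine ⟨?_, by simpa using Real.sqrt_pos.2 h⟩
  have h2 : ‖u‖ ^ 2 = ∑ i, u i * u i := by
    rw [EuclideanSpace.real_norm_sq_eq]
    exact Finset.sum_congr rfl fun i _ => sq (u i)
  simp only [mink, emb_castSucc, emb_last, Real.mul_self_sqrt h.le]
  rw [h2]
  ring

lemma contDiff_emb {d : ℕ} : ContDiff ℝ ∞ (emb (d := d)) := by
  rw [contDiff_euclidean]
  intro i
  refine Fin.lastCases ?_ (fun j => ?_) i
  · simp only [emb_last]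
    exact (contDiff_const.add (contDiff_norm_sq ℝ)).sqrt fun u => by positivity
  · simp only [emb_castSucc]
    fun_prop

/-- The global parametrization `ℝ^d → H^d`, `u ↦ (u, √(1 + |u|²))`. It is a diffeomorphism, with
inverse the projection to the first `d` coordinates. -/
def param (d : ℕ) : Coord d ≃ₜ Hyp d where
  toFun u := ⟨emb u, emb_mem u⟩
  invFun x := WithLp.toLp 2 fun i => x.1 i.castSucc
  left_inv u := by ext i; simp
  right_inv x := by
    obtain ⟨x, hx, hpos⟩ := x
    apply Subtype.ext
    ext i
    refine Fin.lastCases ?_ (fun j => ?_) i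
    · simp only [emb_last, EuclideanSpace.real_norm_sq_eq]
      rw [Real.sqrt_eq_iff_mul_self_eq_of_pos hpos]
      simp only [mink, ← sq] at hx ⊢
      linarith
    · simp
  continuous_toFun := contDiff_emb.continuous.subtype_mk _
  continuous_invFun := by fun_prop

/-! ### Riemannian structure of `H^d` in the global parametrization -/

/-- The standard basis of `ℝ^d`. -/
abbrev basisVec {d : ℕ} (i : Fin d) : Coord d := EuclideanSpace.single i 1

/-- Components `g_{ij}(u) = ⟨∂_i emb, ∂_j emb⟩` of the Riemannian metric which the Minkowski form
induces on `H^d`. -/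
def metric {d : ℕ} (u : Coord d) : Matrix (Fin d) (Fin d) ℝ :=
  Matrix.of fun i j => mink (fderiv ℝ emb u (basisVec i)) (fderiv ℝ emb u (basisVec j))

/-- The Riemannian volume density `√(det g)`. -/
def density {d : ℕ} (u : Coord d) : ℝ := Real.sqrt (metric u).det

/-- The Riemannian volume measure of `H^d`. -/
def vol (d : ℕ) : Measure (Hyp d) :=
  (volume.withDensity fun u : Coord d => ENNReal.ofReal (density u)).map (param d)

/-- The Laplace-Beltrami operator `div ∇` in coordinates:
`ΔF = (1 / √det g) ∑_i ∂_i (√det g ∑_j g^{ij} ∂_j F)`. -/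
def coordLaplacian {d : ℕ} (F : Coord d → ℝ) (u : Coord d) : ℝ :=
  (density u)⁻¹ * ∑ i, fderiv ℝ
    (fun v => density v * ∑ j, (metric v)⁻¹ i j * fderiv ℝ F v (basisVec j)) u (basisVec i)

/-- The Laplace-Beltrami operator of `H^d`. -/
def laplacian {d : ℕ} (f : Hyp d → ℝ) (x : Hyp d) : ℝ :=
  coordLaplacian (f ∘ param d) ((param d).symm x)

lemma fderiv_emb_castSucc {d : ℕ} (u v : Coord d) (i : Fin d) :
    fderiv ℝ emb u v i.castSucc = v i := by
  have hd : DifferentiableAt ℝ (emb (d := d)) u :=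
    (contDiff_emb.differentiable (by simp)) u
  have h1 : HasFDerivAt (fun w : Coord d => emb w i.castSucc)
      ((EuclideanSpace.proj i.castSucc : Mink d →L[ℝ] ℝ).comp (fderiv ℝ emb u)) u :=
    (EuclideanSpace.proj i.castSucc : Mink d →L[ℝ] ℝ).hasFDerivAt.comp u hd.hasFDerivAt
  have h2 : HasFDerivAt (fun w : Coord d => emb w i.castSucc)
      (EuclideanSpace.proj i : Coord d →L[ℝ] ℝ) u := by
    simp only [emb_castSucc]
    exact (EuclideanSpace.proj i : Coord d →L[ℝ] ℝ).hasFDerivAt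
  have := DFunLike.congr_fun (h1.unique h2) v
  simpa using this

lemma fderiv_emb_last {d : ℕ} (u v : Coord d) :
    fderiv ℝ emb u v (Fin.last d) = inner ℝ u v / Real.sqrt (1 + ‖u‖ ^ 2) := by
  have hpos : (0 : ℝ) < 1 + ‖u‖ ^ 2 := by positivity
  have hd : DifferentiableAt ℝ (emb (d := d)) u :=
    (contDiff_emb.differentiable (by simp)) u
  have h1 : HasFDerivAt (fun w : Coord d => emb w (Fin.last d))
      ((EuclideanSpace.proj (Fin.last d) : Mink d →L[ℝ] ℝ).comp (fderiv ℝ emb u)) u :=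
    (EuclideanSpace.proj (Fin.last d) : Mink d →L[ℝ] ℝ).hasFDerivAt.comp u hd.hasFDerivAt
  simp only [emb_last] at h1
  have h2 := (((hasStrictFDerivAt_norm_sq u).hasFDerivAt.const_add 1).sqrt hpos.ne')
  have := DFunLike.congr_fun (h1.unique h2) v
  simp at this
  rw [this]
  field_simp

lemma metric_apply {d : ℕ} (u : Coord d) (i j : Fin d) :
    metric u i j = (if i = j then 1 else 0) - u i * u j / (1 + ‖u‖ ^ 2) := by
  have hpos : (0 : ℝ) < 1 + ‖u‖ ^ 2 := by positivity
  simp only [metric, Matrix.of_apply, mink, fderiv_emb_castSucc, fderiv_emb_last]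
  rw [div_mul_div_comm, Real.mul_self_sqrt hpos.le]
  simp [EuclideanSpace.inner_single_right, eq_comm]

lemma metric_eq {d : ℕ} (u : Coord d) :
    metric u = 1 + Matrix.replicateCol Unit (fun i => -(u i / (1 + ‖u‖ ^ 2))) *
      Matrix.replicateRow Unit (fun j => u j) := by
  ext i j
  rw [metric_apply]
  simp [Matrix.mul_apply, Matrix.one_apply]
  ring

lemma sum_mul_self {d : ℕ} (u : Coord d) : ∑ i, u i * u i = ‖u‖ ^ 2 := by
  rw [EuclideanSpace.real_norm_sq_eq]
  exact Finset.sum_congr rfl fun i _ => (sq (u i)).symm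

lemma det_metric {d : ℕ} (u : Coord d) : (metric u).det = (1 + ‖u‖ ^ 2)⁻¹ := by
  have hpos : (0 : ℝ) < 1 + ‖u‖ ^ 2 := by positivity
  rw [metric_eq, Matrix.det_one_add_replicateCol_mul_replicateRow]
  have : ((fun j => u j) ⬝ᵥ fun i => -(u i / (1 + ‖u‖ ^ 2))) = -(‖u‖ ^ 2 / (1 + ‖u‖ ^ 2)) := by
    rw [← sum_mul_self u, Finset.sum_div, ← Finset.sum_neg_distrib]
    exact Finset.sum_congr rfl fun i _ => by ring
  rw [this]
  field_simp
  ring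

lemma metric_inv_apply {d : ℕ} (u : Coord d) (i j : Fin d) :
    (metric u)⁻¹ i j = (if i = j then 1 else 0) + u i * u j := by
  have hpos : (0 : ℝ) < 1 + ‖u‖ ^ 2 := by positivity
  have : (metric u)⁻¹ = Matrix.of fun i j => (if i = j then (1 : ℝ) else 0) + u i * u j := by
    apply Matrix.inv_eq_right_inv
    ext a b
    simp only [Matrix.mul_apply, metric_apply, Matrix.of_apply, Matrix.one_apply]
    have : ∀ k, ((if a = k then (1 : ℝ) else 0) - u a * u k / (1 + ‖u‖ ^ 2)) *
        ((if k = b then 1 else 0) + u k * u b) =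
        (if a = k then ((if k = b then 1 else 0) + u k * u b) else 0) -
          (if k = b then u a * u k / (1 + ‖u‖ ^ 2) else 0) -
          u a * u b / (1 + ‖u‖ ^ 2) * (u k * u k) := by
      intro k
      split_ifs <;> ring
    simp only [this, Finset.sum_sub_distrib, ← Finset.mul_sum, sum_mul_self]
    simp
    field_simp
    ring
  rw [this, Matrix.of_apply]

lemma density_pos {d : ℕ} (u : Coord d) : 0 < density u := by
  rw [density, det_metric]
  positivity

lemma contDiff_density {d : ℕ} : ContDiff ℝ ∞ (density (d := d)) := by
  have h : density (d := d) = fun u => Real.sqrt (1 + ‖u‖ ^ 2)⁻¹ := by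
    funext u; rw [density, det_metric]
  rw [h]
  have hp : ∀ u : Coord d, (1 + ‖u‖ ^ 2 : ℝ) ≠ 0 := fun u => by positivity
  exact ((contDiff_const.add (contDiff_norm_sq ℝ)).inv hp).sqrt fun u => inv_ne_zero (hp u)

lemma contDiff_metric_inv {d : ℕ} (i j : Fin d) :
    ContDiff ℝ ∞ fun u : Coord d => (metric u)⁻¹ i j := by
  simp only [metric_inv_apply]
  fun_prop

lemma contDiff_fderiv_basisVec {d : ℕ} {F : Coord d → ℝ} (hF : ContDiff ℝ ∞ F) (i : Fin d) :
    ContDiff ℝ ∞ fun u => fderiv ℝ F u (basisVec i) :=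
  (hF.fderiv_right (m := ∞) (by simp)).clm_apply contDiff_const

lemma contDiff_coordLaplacian {d : ℕ} {F : Coord d → ℝ} (hF : ContDiff ℝ ∞ F) :
    ContDiff ℝ ∞ (coordLaplacian F) := by
  unfold coordLaplacian
  refine (contDiff_density.inv fun u => (density_pos u).ne').mul
    (ContDiff.sum fun i _ => contDiff_fderiv_basisVec ?_ i)
  exact contDiff_density.mul
    (ContDiff.sum fun j _ => (contDiff_metric_inv i j).mul (contDiff_fderiv_basisVec hF j))

lemma coordLaplacian_eq_zero {d : ℕ} {F : Coord d → ℝ} {u : Coord d} (hu : u ∉ tsupport F) :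
    coordLaplacian F u = 0 := by
  have h0 : ∀ᶠ v in nhds u, v ∉ tsupport F :=
    (isClosed_tsupport F).isOpen_compl.eventually_mem hu
  have h1 : ∀ i : Fin d, (fun v => density v *
      ∑ j, (metric v)⁻¹ i j * fderiv ℝ F v (basisVec j)) =ᶠ[nhds u] fun _ => 0 := by
    intro i
    filter_upwards [h0] with v hv
    have : fderiv ℝ F v = 0 := by
      by_contra h
      exact hv (support_fderiv_subset ℝ h)
    simp [this]
  simp [coordLaplacian, (h1 _).fderiv_eq]

/-! ### Test functions and distributions on `H^d` -/

/-- The space `D(H^d) = C_c^∞(H^d)` of real test functions. -/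
structure TestFn (d : ℕ) where
  toFun : Hyp d → ℝ
  smooth' : ContDiff ℝ ∞ (toFun ∘ param d)
  hasCompactSupport' : HasCompactSupport toFun

namespace TestFn

variable {d : ℕ}

instance : FunLike (TestFn d) (Hyp d) ℝ where
  coe f := f.toFun
  coe_injective f g h := by cases f; cases g; congr

lemma smooth (f : TestFn d) : ContDiff ℝ ∞ (f ∘ param d) := f.smooth'

lemma hasCompactSupport (f : TestFn d) : HasCompactSupport f := f.hasCompactSupport'

instance : Zero (TestFn d) := ⟨⟨0, contDiff_const, HasCompactSupport.zero⟩⟩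

instance : Add (TestFn d) :=
  ⟨fun f g => ⟨f + g, f.smooth.add g.smooth, f.hasCompactSupport.add g.hasCompactSupport⟩⟩

instance : Neg (TestFn d) := ⟨fun f => ⟨-f, f.smooth.neg, f.hasCompactSupport.neg⟩⟩

instance : Sub (TestFn d) :=
  ⟨fun f g => ⟨f - g, f.smooth.sub g.smooth, f.hasCompactSupport.sub g.hasCompactSupport⟩⟩

instance {R : Type} [Semiring R] [Module R ℝ] [SMulCommClass ℝ R ℝ] [ContinuousConstSMul R ℝ] :
    SMul R (TestFn d) :=
  ⟨fun c f => ⟨c • ⇑f, f.smooth.const_smul c, f.hasCompactSupport.smul_left⟩⟩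

instance : AddCommGroup (TestFn d) :=
  DFunLike.coe_injective.addCommGroup _ rfl (fun _ _ => rfl) (fun _ => rfl) (fun _ _ => rfl)
    (fun _ _ => rfl) (fun _ _ => rfl)

instance : Module ℝ (TestFn d) :=
  DFunLike.coe_injective.module ℝ
    ({ toFun := fun f => ⇑f, map_zero' := rfl, map_add' := fun _ _ => rfl } :
      TestFn d →+ (Hyp d → ℝ)) fun _ _ => rfl

@[simp] lemma add_apply (f g : TestFn d) (x : Hyp d) : (f + g) x = f x + g x := rfl

@[simp] lemma sub_apply (f g : TestFn d) (x : Hyp d) : (f - g) x = f x - g x := rfl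

@[simp] lemma smul_apply (c : ℝ) (f : TestFn d) (x : Hyp d) : (c • f) x = c * f x := rfl

/-- A test function on `H^d`, read in the global parametrization as a test function on `ℝ^d`. -/
def pullback (f : TestFn d) : 𝓓((⊤ : TopologicalSpace.Opens (Coord d)), ℝ) where
  toFun := f ∘ param d
  contDiff' := f.smooth
  hasCompactSupport' := f.hasCompactSupport.comp_homeomorph (param d)
  tsupport_subset' := fun _ _ => trivial

/-- The canonical (LF) topology of `D(H^d)`: it is transported from `D(ℝ^d)` by the linear
bijection which the global diffeomorphism `ℝ^d ≅ H^d` induces. -/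
instance : TopologicalSpace (TestFn d) := TopologicalSpace.induced pullback inferInstance

/-- The Laplacian of a test function. -/
def lap (f : TestFn d) : TestFn d where
  toFun := laplacian f
  smooth' := by
    have : laplacian f ∘ param d = coordLaplacian (f ∘ param d) := by
      funext u; simp [laplacian]
    rw [this]
    exact contDiff_coordLaplacian f.smooth
  hasCompactSupport' := by
    have h : HasCompactSupport (coordLaplacian (f ∘ param d)) :=
      (f.hasCompactSupport.comp_homeomorph (param d)).mono' fun u hu => by
        by_contra h
        exact hu (coordLaplacian_eq_zero h)
    exact h.comp_homeomorph (param d).symm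

end TestFn

/-- The space `D'(H^d)` of distributions: continuous linear functionals on `D(H^d)`. -/
abbrev Distrib (d : ℕ) : Type := TestFn d →L[ℝ] ℝ

/-- `h` solves `(1/d) Δh - h = μ` in `D'(H^d)`: for every test function `f`,
`(h, (1/d) Δf - f) = ∫ f dμ`. -/
def IsDistribSolution {d : ℕ} (h : Distrib d) (μ : Measure (Hyp d)) : Prop :=
  ∀ f : TestFn d, h ((1 / (d : ℝ)) • f.lap - f) = ∫ x, f x ∂μ

/-! ### The kernel `G` -/

/-- The area `v_{d-1}` of the unit sphere of `ℝ^d`. -/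
def sphereArea (d : ℕ) : ℝ := ((volume : Measure (Coord d)).toSphere).real Set.univ

/-- `k(ρ) = (cosh ρ / v_{d-1}) ∫_{+∞}^ρ dt / (sinh^{d-1} t cosh² t)` for `ρ > 0`. -/
def k (d : ℕ) (ρ : ℝ) : ℝ :=
  Real.cosh ρ / sphereArea d *
    -∫ t in Set.Ioi ρ, 1 / (Real.sinh t ^ (d - 1) * Real.cosh t ^ 2)

/-- `G(x, y) = k(d(x, y))`. The diagonal, where `G` is infinite and this real-valued `G` has no
meaning, is null for `vol` and plays no role below. -/
def G {d : ℕ} (x y : Hyp d) : ℝ := k d (hdist x y)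

/-- `h_f(x) = d ∫ G(x, y) f(y) dvol(y)`. -/
def potential {d : ℕ} (f : Hyp d → ℝ) (x : Hyp d) : ℝ := d * ∫ y, G x y * f y ∂vol d

/-- The decay condition `∫_{H^d ∖ B_1(x₀)} |G(x₀, y)| dμ(y) < ∞` for some `x₀`. -/
def DecayCondition {d : ℕ} (μ : Measure (Hyp d)) : Prop :=
  ∃ x₀ : Hyp d, ∫⁻ y in {y | 1 ≤ hdist x₀ y}, ENNReal.ofReal |G x₀ y| ∂μ < ⊤

end Hyperbolic

end

noncomputable section

namespace Hyperbolic

open Set Filter Topology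

/-! ### The regularized radial kernel -/

/-! The heart of the matter is that `d G(x, ·)` is a fundamental solution of `Δ/d - 1`, so that the
potential of `Δf/d - f` is `f` itself (`potential_lap_sub`). Integrating this identity against `μ`
is the distributional equation. The rest is absolute convergence and continuity.

Fundamental solution. In the variable `c = cosh ρ`, a radial function `φ(c)` has Laplacian `(c² - 1)
φ'' + d c φ'`. The function `c` solves `Δφ = d φ`, and `k` is the second solution obtained by
reduction of order. Instead of excising a ball around the pole, the proof replaces `s² - 1` by `s² -
1 + δ` under the integral. The new kernel is regular on `c ≥ 1`, so Green's formula has no boundary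
term (`integral_radial_mul_coordLaplacian`), and `Δ - d` maps it exactly to `(d / v_{d-1}) δ (r² +
δ)^{-(d+2)/2}` with `r = sinh ρ` (`kern_equation`). This is an approximate identity: its rescaled
profile has Lebesgue integral 1 on `ℝ^d`. Letting `δ → 0` by dominated convergence on both sides
gives `integral_kern_mul_lap_sub`.

Estimates. The kernel is `O(r^{1-d})` near the pole, hence locally integrable, and comparable to
`c^{-d}` at infinity. Since `cosh d(x, y)` is comparable to the height `x_{d+1}` for `y` in a
bounded set, potentials of test functions supported in a fixed ball are at most `C sup|f|
x_{d+1}^{-d}` (`exists_abs_potential_le`), while the decay condition says that `x_{d+1}^{-d}` is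
`μ`-integrable (`integrable_height_inv`). Both integrability with respect to `μ` and continuity of
the functional follow.

Lorentz reflections (`exists_lorentz`) move any point to the origin, so local integrability and the
approximate identity need only be studied there. -/

/-- The integrand `s⁻² (s² - 1 + δ)^{-d/2}`; for `δ = 0` this is the integrand of the kernel `k`
after the substitution `s = cosh t`. -/
def tailDensity (d : ℕ) (δ s : ℝ) : ℝ := (√(s ^ 2 - 1 + δ) ^ d * s ^ 2)⁻¹

/-- The tail integral of `tailDensity`. -/
def tail (d : ℕ) (δ c : ℝ) : ℝ := ∫ s in Ioi c, tailDensity d δ s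

/-- The regularized kernel, as a function of `c = cosh ρ`. -/
def kern (d : ℕ) (δ c : ℝ) : ℝ := c / sphereArea d * -tail d δ c

/-- The derivative of the regularized kernel. -/
def kernDeriv (d : ℕ) (δ c : ℝ) : ℝ :=
  (sphereArea d)⁻¹ * (-tail d δ c + (√(c ^ 2 - 1 + δ) ^ d * c)⁻¹)

/-- The second derivative of the regularized kernel. -/
def kernDeriv₂ (d : ℕ) (δ c : ℝ) : ℝ :=
  -(sphereArea d)⁻¹ * d * (√(c ^ 2 - 1 + δ) ^ (d + 2))⁻¹

lemma sphereArea_pos {d : ℕ} (hd : d ≠ 0) : 0 < sphereArea d := by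
  have : Nonempty (Fin d) := ⟨⟨0, Nat.pos_of_ne_zero hd⟩⟩
  have : Nontrivial (Coord d) := inferInstance
  rw [sphereArea, measureReal_def, ENNReal.toReal_pos_iff]
  refine ⟨?_, measure_lt_top _ _⟩
  rw [pos_iff_ne_zero, Ne, Measure.measure_univ_eq_zero]
  exact Measure.toSphere_ne_zero _

lemma measurable_tailDensity (d : ℕ) (δ : ℝ) : Measurable (tailDensity d δ) := by
  unfold tailDensity; fun_prop

lemma tailDensity_nonneg (d : ℕ) (δ s : ℝ) : 0 ≤ tailDensity d δ s := by
  unfold tailDensity; positivity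

lemma continuousAt_tailDensity (d : ℕ) {δ s : ℝ} (hs : 0 < s) (h : 0 < s ^ 2 - 1 + δ) :
    ContinuousAt (tailDensity d δ) s := by
  have : √(s ^ 2 - 1 + δ) ^ d * s ^ 2 ≠ 0 := by
    have := Real.sqrt_pos.2 h
    positivity
  unfold tailDensity
  exact ContinuousAt.inv₀ (by fun_prop) this

lemma integrableOn_inv_sq {c : ℝ} (hc : 0 < c) : IntegrableOn (fun s : ℝ => (s ^ 2)⁻¹) (Ioi c) := by
  refine (integrableOn_Ioi_rpow_of_lt (a := -2) (by norm_num) hc).congr_fun (fun s hs => ?_)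
    measurableSet_Ioi
  have hs' : (0 : ℝ) ≤ s := (hc.trans hs).le
  simp [Real.rpow_neg hs']

lemma integral_inv_pow {c : ℝ} (hc : 0 < c) (n : ℕ) :
    ∫ s in Ioi c, (s ^ (n + 2))⁻¹ = (c ^ (n + 1))⁻¹ / (n + 1) := by
  have h := integral_Ioi_rpow_of_lt (a := -((n + 2 : ℕ) : ℝ)) (by push_cast; linarith) hc
  have h2 : ∫ s in Ioi c, (s ^ (n + 2))⁻¹ = ∫ s in Ioi c, s ^ (-((n + 2 : ℕ) : ℝ)) := by
    refine setIntegral_congr_fun measurableSet_Ioi fun s hs => ?_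
    have hs' : (0 : ℝ) ≤ s := (hc.trans hs).le
    simp only [Real.rpow_neg hs', Real.rpow_natCast]
  rw [h2, h, show (-((n + 2 : ℕ) : ℝ)) + 1 = -((n + 1 : ℕ) : ℝ) by push_cast; ring,
    Real.rpow_neg hc.le, Real.rpow_natCast]
  push_cast
  rw [neg_div_neg_eq]

lemma tailDensity_le (d : ℕ) {δ c s : ℝ} (hc : 0 < c) (h : 0 < c ^ 2 - 1 + δ) (hs : c ≤ s) :
    tailDensity d δ s ≤ (√(c ^ 2 - 1 + δ) ^ d)⁻¹ * (s ^ 2)⁻¹ := by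
  have := Real.sqrt_pos.2 h
  have hs0 : 0 < s := hc.trans_le hs
  rw [tailDensity, mul_inv]
  gcongr

lemma integrableOn_tailDensity (d : ℕ) {δ c : ℝ} (hc : 0 < c) (h : 0 < c ^ 2 - 1 + δ) :
    IntegrableOn (tailDensity d δ) (Ioi c) := by
  refine ((integrableOn_inv_sq hc).const_mul (√(c ^ 2 - 1 + δ) ^ d)⁻¹).mono'
    (measurable_tailDensity d δ).aestronglyMeasurable ?_
  filter_upwards [ae_restrict_mem measurableSet_Ioi] with s hs
  rw [Real.norm_of_nonneg (tailDensity_nonneg d δ s)]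
  exact tailDensity_le d hc h (le_of_lt hs)

lemma tail_nonneg (d : ℕ) (δ c : ℝ) : 0 ≤ tail d δ c :=
  integral_nonneg fun s => tailDensity_nonneg d δ s

lemma hasDerivAt_tail (d : ℕ) {δ c : ℝ} (hc : 0 < c) (h : 0 < c ^ 2 - 1 + δ) :
    HasDerivAt (tail d δ) (-tailDensity d δ c) c := by
  have hcont := continuousAt_tailDensity d hc h
  have h1 : HasDerivAt (fun x => ∫ s in c..x, tailDensity d δ s) (tailDensity d δ c) c :=
    intervalIntegral.integral_hasDerivAt_right (by simp)
      (measurable_tailDensity d δ).stronglyMeasurable.stronglyMeasurableAtFilter hcont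
  -- For `x` near `c`, the tail at `x` is the tail at `c` minus the integral over `[c, x]`.
  refine (h1.const_sub (tail d δ c)).congr_of_eventuallyEq ?_
  have e1 : ∀ᶠ x in 𝓝 c, 0 < x := lt_mem_nhds hc
  have e2 : ∀ᶠ x in 𝓝 c, 0 < x ^ 2 - 1 + δ :=
    ((by fun_prop : Continuous fun x : ℝ => x ^ 2 - 1 + δ).tendsto c).eventually (lt_mem_nhds h)
  filter_upwards [e1, e2] with x hx1 hx2
  rw [← intervalIntegral.integral_Ioi_sub_Ioi' (integrableOn_tailDensity d hc h)
    (integrableOn_tailDensity d hx1 hx2)]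
  simp [tail]

lemma hasDerivAt_kern (d : ℕ) {δ c : ℝ} (hc : 0 < c) (h : 0 < c ^ 2 - 1 + δ) :
    HasDerivAt (kern d δ) (kernDeriv d δ c) c := by
  have := ((hasDerivAt_id c).div_const (sphereArea d)).mul (hasDerivAt_tail d hc h).neg
  refine this.congr_deriv ?_
  simp only [kernDeriv, tailDensity, id, Pi.neg_apply]
  field_simp

/-- With `r = √(c² - 1 + δ)`, the derivative of `-tail` is `(r^d c²)⁻¹`; it cancels the contribution
of the factor `c⁻¹` in `(r^d c)⁻¹`, so only the derivative of `r^{-d}` survives. -/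
lemma hasDerivAt_kernDeriv (d : ℕ) {δ c : ℝ} (hc : 0 < c) (h : 0 < c ^ 2 - 1 + δ) :
    HasDerivAt (kernDeriv d δ) (kernDeriv₂ d δ c) c := by
  have hr := Real.sqrt_pos.2 h
  have h0 : HasDerivAt (fun x : ℝ => x ^ 2 - 1 + δ) (2 * c) c := by
    simpa using ((hasDerivAt_pow 2 c).sub_const 1).add_const δ
  have h1 := ((h0.sqrt h.ne').pow d).mul (hasDerivAt_id c)
  have h2 := h1.inv (by simp only [Pi.mul_apply, Pi.pow_apply, id]; positivity)
  have h3 := ((hasDerivAt_tail d hc h).neg.add h2).const_mul (sphereArea d)⁻¹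
  refine h3.congr_deriv ?_
  simp only [kernDeriv₂, tailDensity, id, Pi.mul_apply, Pi.pow_apply]
  rcases d with _ | d
  · simp; right; field_simp; ring
  · simp only [Nat.add_sub_cancel]
    generalize (sphereArea (d + 1))⁻¹ = v
    push_cast
    field_simp
    ring

lemma continuousOn_kernDeriv₂ (d : ℕ) {δ : ℝ} (hδ : 0 < δ) :
    ContinuousOn (kernDeriv₂ d δ) (Ici 1) := by
  unfold kernDeriv₂
  refine ContinuousOn.mul continuousOn_const (ContinuousOn.inv₀ (by fun_prop) fun c hc => ?_)
  have h1 : (1 : ℝ) ≤ c := hc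
  have : 0 < √(c ^ 2 - 1 + δ) := Real.sqrt_pos.2 (by nlinarith)
  positivity

/-- The approximate identity `(d / v_{d-1}) δ (r² + δ)^{-(d+2)/2}`. -/
def approxId (d : ℕ) (δ q : ℝ) : ℝ := d / sphereArea d * (δ * (√(q + δ) ^ (d + 2))⁻¹)

/-- The tail integrals cancel because `c` solves the homogeneous equation. What remains is `(d /
v_{d-1}) (r² - (c² - 1)) r^{-(d+2)}` with `r² = c² - 1 + δ`. -/
lemma kern_equation (d : ℕ) {δ c : ℝ} (hc : 0 < c) (h : 0 < c ^ 2 - 1 + δ) :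
    (c ^ 2 - 1) * kernDeriv₂ d δ c + d * c * kernDeriv d δ c - d * kern d δ c =
      approxId d δ (c ^ 2 - 1) := by
  have hr := Real.sqrt_pos.2 h
  have hsq : √(c ^ 2 - 1 + δ) ^ 2 = c ^ 2 - 1 + δ := Real.sq_sqrt h.le
  simp only [kern, kernDeriv, kernDeriv₂, approxId]
  set r := √(c ^ 2 - 1 + δ)
  -- Division by zero being zero, both sides vanish in this case.
  by_cases hv : sphereArea d = 0
  · simp [hv]
  have hc2 : c ^ 2 - 1 = r ^ 2 - δ := by linarith
  rw [hc2]
  field_simp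
  ring

/-! ### Bounds and limits of the tail integral. -/

lemma tail_le (d : ℕ) {δ c : ℝ} (hc : 0 < c) (h : 0 < c ^ 2 - 1 + δ) :
    tail d δ c ≤ (√(c ^ 2 - 1 + δ) ^ d)⁻¹ * c⁻¹ := by
  have h1 : ∫ s in Ioi c, (s ^ 2)⁻¹ = c⁻¹ := by simpa using integral_inv_pow hc 0
  rw [← h1, ← integral_const_mul]
  exact setIntegral_mono_on (integrableOn_tailDensity d hc h)
    ((integrableOn_inv_sq hc).const_mul _) measurableSet_Ioi
    fun s hs => tailDensity_le d hc h (le_of_lt hs)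

lemma tailDensity_le_zero (d : ℕ) {δ s : ℝ} (hδ : 0 ≤ δ) (hs : 1 < s) :
    tailDensity d δ s ≤ tailDensity d 0 s := by
  have h : 0 < s ^ 2 - 1 + 0 := by nlinarith
  have hr := Real.sqrt_pos.2 h
  have hs0 : 0 < s := by linarith
  unfold tailDensity
  gcongr

/-- Increasing `δ` shrinks the integrand, so the singular kernel itself dominates all its
regularizations in `tendsto_integral_kern`. -/
lemma tail_le_tail_zero (d : ℕ) {δ c : ℝ} (hδ : 0 ≤ δ) (hc : 1 < c) :
    tail d δ c ≤ tail d 0 c :=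
  setIntegral_mono_on (integrableOn_tailDensity d (by linarith) (by nlinarith))
    (integrableOn_tailDensity d (by linarith) (by nlinarith)) measurableSet_Ioi
    fun _ hs => tailDensity_le_zero d hδ (hc.trans hs)

/-- Since `√(s² - 1) ≤ s`, the integrand is at least `s^{-(d+2)}`. This lower bound is what turns
the decay condition on `G` into integrability of a power of the height. -/
lemma le_tail_zero (d : ℕ) {c : ℝ} (hc : 1 < c) :
    (c ^ (d + 1))⁻¹ / (d + 1) ≤ tail d 0 c := by
  have hc0 : 0 < c := by linarith
  have hpt : ∀ s ∈ Ioi c, (s ^ (d + 2))⁻¹ ≤ tailDensity d 0 s := by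
    intro s hs
    have hs1 : 1 < s := hc.trans hs
    have h : 0 < s ^ 2 - 1 + 0 := by nlinarith
    have hr := Real.sqrt_pos.2 h
    have hle : √(s ^ 2 - 1 + 0) ≤ s := Real.sqrt_le_iff.2 ⟨by linarith, by linarith⟩
    rw [tailDensity, pow_add]
    gcongr
  rw [← integral_inv_pow hc0 d]
  have hi := integrableOn_tailDensity d (δ := 0) hc0 (by nlinarith)
  refine setIntegral_mono_on (hi.mono' (by fun_prop) ?_) hi measurableSet_Ioi hpt
  filter_upwards [ae_restrict_mem measurableSet_Ioi] with s hs
  have : 0 < s := hc0.trans hs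
  rw [Real.norm_of_nonneg (by positivity)]
  exact hpt s hs

lemma tendsto_tail_zero (d : ℕ) {c : ℝ} (hc : 1 < c) :
    Tendsto (fun δ => tail d δ c) (𝓝[>] 0) (𝓝 (tail d 0 c)) := by
  refine tendsto_integral_filter_of_dominated_convergence (tailDensity d 0) ?_ ?_
    (integrableOn_tailDensity d (by linarith) (by nlinarith)) ?_
  · exact .of_forall fun δ => (measurable_tailDensity d δ).aestronglyMeasurable
  · filter_upwards [self_mem_nhdsWithin] with δ hδ
    filter_upwards [ae_restrict_mem measurableSet_Ioi] with s hs
    rw [Real.norm_of_nonneg (tailDensity_nonneg d δ s)]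
    exact tailDensity_le_zero d (le_of_lt hδ) (hc.trans hs)
  · filter_upwards [ae_restrict_mem measurableSet_Ioi] with s hs
    have hs1 : 1 < s := hc.trans hs
    have h : 0 < s ^ 2 - 1 + 0 := by nlinarith
    have hr := Real.sqrt_pos.2 h
    have hne : √(s ^ 2 - 1 + 0) ^ d * s ^ 2 ≠ 0 := by positivity
    refine Tendsto.mono_left ?_ nhdsWithin_le_nhds
    have : ContinuousAt (fun δ => (√(s ^ 2 - 1 + δ) ^ d * s ^ 2)⁻¹) 0 :=
      ContinuousAt.inv₀ (by fun_prop) hne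
    exact this

lemma tendsto_tail_atTop (d : ℕ) : Tendsto (tail d 0) atTop (𝓝 0) := by
  refine squeeze_zero' (.of_forall fun c => tail_nonneg d 0 c) ?_ tendsto_inv_atTop_zero
  filter_upwards [eventually_ge_atTop 2] with c hc
  have h1 : 1 ≤ √(c ^ 2 - 1 + 0) := Real.one_le_sqrt.2 (by nlinarith)
  refine (tail_le d (by linarith) (by nlinarith)).trans ?_
  have hc0 : 0 < c := by linarith
  exact mul_le_of_le_one_left (by positivity) (inv_le_one_of_one_le₀ (one_le_pow₀ h1))

/-- The substitution `s = cosh t` in the definition of `k`. -/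
lemma k_eq_kern {d : ℕ} (hd : d ≠ 0) {ρ : ℝ} (hρ : 0 < ρ) : k d ρ = kern d 0 (Real.cosh ρ) := by
  -- Writing the dimension as a successor makes the truncated exponent `d - 1` a genuine one.
  obtain ⟨d, rfl⟩ := Nat.exists_eq_succ_of_ne_zero hd
  have hmem : ∀ t ∈ Ici ρ, 0 < Real.cosh t ^ 2 - 1 + 0 := fun t ht => by
    have : 1 < Real.cosh t := Real.one_lt_cosh.2 (hρ.trans_le ht).ne'
    nlinarith
  have hcosh : Tendsto Real.cosh atTop atTop :=
    tendsto_atTop_mono' _ ((eventually_ge_atTop 0).mono fun t ht =>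
      (Real.self_le_sinh_iff.2 ht).trans (Real.sinh_lt_cosh t).le) tendsto_id
  -- The substitution is carried out by exhibiting `-tail (cosh t)`, which tends to 0, as a
  -- primitive.
  have hI := integral_Ioi_of_hasDerivAt_of_nonneg' (a := ρ) (l := 0)
    (g := fun t => -tail (d + 1) 0 (Real.cosh t))
    (g' := fun t => tailDensity (d + 1) 0 (Real.cosh t) * Real.sinh t)
    (fun t ht => by
      have := ((hasDerivAt_tail (d + 1) (Real.cosh_pos t) (hmem t ht)).comp t
        (Real.hasDerivAt_cosh t)).neg
      exact this.congr_deriv (by ring))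
    (fun t ht => mul_nonneg (tailDensity_nonneg _ _ _)
      (Real.sinh_nonneg_iff.2 (hρ.trans ht).le))
    (by simpa using ((tendsto_tail_atTop (d + 1)).comp hcosh).neg)
  have h2 : ∀ t ∈ Ioi ρ, 1 / (Real.sinh t ^ (d + 1 - 1) * Real.cosh t ^ 2) =
      tailDensity (d + 1) 0 (Real.cosh t) * Real.sinh t := by
    intro t ht
    have hs : 0 < Real.sinh t := Real.sinh_pos_iff.2 (hρ.trans ht)
    have : Real.cosh t ^ 2 - 1 + 0 = Real.sinh t ^ 2 := by rw [Real.cosh_sq]; ring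
    rw [tailDensity, this, Real.sqrt_sq hs.le]
    have := Real.cosh_pos t
    simp only [Nat.add_sub_cancel]
    field_simp
    ring
  rw [k, kern, setIntegral_congr_fun measurableSet_Ioi h2, hI]
  simp

/-- Near the pole the kernel is at most `(c / v_{d-1}) r^{1-d}` with `r = √(c² - 1)`. -/
lemma tail_zero_le_near (d : ℕ) {c : ℝ} (hc : 1 < c) :
    tail (d + 1) 0 c ≤ (√(c ^ 2 - 1) ^ d)⁻¹ := by
  have hc0 : 0 < c := by linarith
  -- In dimension one the integrand has the primitive `√(s² - 1) / s`, with limit 1 at infinity. The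
  -- remaining `d` factors `√(s² - 1)⁻¹` are bounded by their value at `c`.
  have hderiv : ∀ s ∈ Ici c, HasDerivAt (fun s : ℝ => √(s ^ 2 - 1) / s)
      ((√(s ^ 2 - 1) * s ^ 2)⁻¹) s := by
    intro s hs
    have hs1 : 1 < s := hc.trans_le hs
    have h : 0 < s ^ 2 - 1 := by nlinarith
    have hr := Real.sqrt_pos.2 h
    have h0 : HasDerivAt (fun x : ℝ => x ^ 2 - 1) (2 * s) s := by
      simpa using (hasDerivAt_pow 2 s).sub_const 1
    refine ((h0.sqrt h.ne').div (hasDerivAt_id s) (by simp; linarith)).congr_deriv ?_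
    have hsq : √(s ^ 2 - 1) ^ 2 = s ^ 2 - 1 := Real.sq_sqrt h.le
    simp only [id]
    field_simp
    rw [hsq]
    ring
  have hlim : Tendsto (fun s : ℝ => √(s ^ 2 - 1) / s) atTop (𝓝 1) := by
    have : Tendsto (fun s : ℝ => √(1 - s⁻¹ ^ 2)) atTop (𝓝 1) := by
      have h := (tendsto_inv_atTop_zero (𝕜 := ℝ)).pow 2
      have h2 := (h.const_sub 1).sqrt
      simpa using h2
    refine this.congr' ?_
    filter_upwards [eventually_ge_atTop 1] with s hs
    have hs0 : (0 : ℝ) < s := by linarith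
    rw [eq_div_iff hs0.ne']
    nth_rewrite 2 [← Real.sqrt_sq hs0.le]
    rw [← Real.sqrt_mul' _ (by positivity)]
    congr 1
    field_simp
  have hnn : ∀ s ∈ Ioi c, 0 ≤ (√(s ^ 2 - 1) * s ^ 2)⁻¹ := fun s hs => by positivity
  have hint := integrableOn_Ioi_deriv_of_nonneg' hderiv hnn hlim
  have hval := integral_Ioi_of_hasDerivAt_of_nonneg' hderiv hnn hlim
  calc tail (d + 1) 0 c
      ≤ ∫ s in Ioi c, (√(c ^ 2 - 1) ^ d)⁻¹ * (√(s ^ 2 - 1) * s ^ 2)⁻¹ := by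
        refine setIntegral_mono_on (integrableOn_tailDensity _ hc0 (by nlinarith))
          (hint.const_mul _) measurableSet_Ioi fun s hs => ?_
        have hs1 : c < s := hs
        have hr := Real.sqrt_pos.2 (show 0 < c ^ 2 - 1 by nlinarith)
        have hr' := Real.sqrt_pos.2 (show 0 < s ^ 2 - 1 by nlinarith)
        have hs0 : 0 < s := by linarith
        rw [tailDensity, add_zero, ← mul_inv, pow_succ, mul_assoc]
        gcongr
    _ = (√(c ^ 2 - 1) ^ d)⁻¹ * (1 - √(c ^ 2 - 1) / c) := by rw [integral_const_mul, hval]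
    _ ≤ (√(c ^ 2 - 1) ^ d)⁻¹ :=
        mul_le_of_le_one_right (by positivity) (by
          have : 0 ≤ √(c ^ 2 - 1) / c := by positivity
          linarith)

/-- Here `√(c² - 1) ≥ c / 2`. Together with the prefactor `c` of `kern` this gives decay of order
`c^{-d}`. -/
lemma tail_zero_le_far (d : ℕ) {c : ℝ} (hc : 2 ≤ c) :
    tail d 0 c ≤ 2 ^ d * (c ^ (d + 1))⁻¹ := by
  have hc0 : 0 < c := by linarith
  refine (tail_le d hc0 (by nlinarith)).trans ?_
  have hr : c / 2 ≤ √(c ^ 2 - 1 + 0) := Real.le_sqrt_of_sq_le (by nlinarith)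
  calc (√(c ^ 2 - 1 + 0) ^ d)⁻¹ * c⁻¹ ≤ ((c / 2) ^ d)⁻¹ * c⁻¹ := by gcongr
    _ = 2 ^ d * (c ^ (d + 1))⁻¹ := by
      rw [div_pow, pow_succ]
      field_simp

/-! ### The Minkowski form on the hyperboloid -/

section Mink

variable {d : ℕ}

lemma mink_comm (x y : Mink d) : mink x y = mink y x := by
  simp only [mink, mul_comm]

/-- The Minkowski form as a bilinear map. -/
def minkForm (d : ℕ) : Mink d →ₗ[ℝ] Mink d →ₗ[ℝ] ℝ :=
  LinearMap.mk₂ ℝ mink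
    (fun x y z => by simp [mink, add_mul, Finset.sum_add_distrib]; ring)
    (fun c x y => by simp [mink, mul_sub, Finset.mul_sum, mul_assoc])
    (fun x y z => by simp [mink, mul_add, Finset.sum_add_distrib]; ring)
    (fun c x y => by simp [mink, mul_sub, Finset.mul_sum, mul_left_comm])

lemma minkForm_apply (x y : Mink d) : minkForm d x y = mink x y := rfl

lemma continuous_mink : Continuous fun p : Mink d × Mink d => mink p.1 p.2 := by
  unfold mink; fun_prop

lemma emb_param_symm (x : Hyp d) : emb ((param d).symm x) = x.1 :=
  congrArg Subtype.val ((param d).apply_symm_apply x)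

lemma mink_emb (u w : Coord d) :
    mink (emb u) (emb w) = inner ℝ u w - √(1 + ‖u‖ ^ 2) * √(1 + ‖w‖ ^ 2) := by
  simp only [mink, emb_castSucc, emb_last, PiLp.inner_apply]
  congr 1
  exact Finset.sum_congr rfl fun i _ => by simp [mul_comm]

/-- The hyperbolic cosine of the distance. -/
def coshDist (x y : Hyp d) : ℝ := -mink x.1 y.1

lemma coshDist_comm (x y : Hyp d) : coshDist x y = coshDist y x := by
  simp only [coshDist, mink_comm]

lemma continuous_coshDist : Continuous fun p : Hyp d × Hyp d => coshDist p.1 p.2 :=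
  (continuous_mink.comp (by fun_prop :
    Continuous fun p : Hyp d × Hyp d => ((p.1.1, p.2.1) : Mink d × Mink d))).neg

/-- The last coordinate `x_{d+1}` of a point of hyperbolic space. -/
def height (x : Hyp d) : ℝ := x.1 (Fin.last d)

lemma height_param (u : Coord d) : height (param d u) = √(1 + ‖u‖ ^ 2) := emb_last u

lemma continuous_height : Continuous (height (d := d)) := by unfold height; fun_prop

lemma one_le_height (x : Hyp d) : 1 ≤ height x := by
  obtain ⟨u, rfl⟩ := (param d).surjective x
  rw [height_param, Real.one_le_sqrt]
  nlinarith [sq_nonneg ‖u‖]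

lemma coshDist_param (u w : Coord d) :
    coshDist (param d u) (param d w) = √(1 + ‖u‖ ^ 2) * √(1 + ‖w‖ ^ 2) - inner ℝ u w := by
  rw [coshDist, show (param d u).1 = emb u from rfl, show (param d w).1 = emb w from rfl, mink_emb]
  ring

lemma one_add_le_sqrt_mul_sqrt (a b : ℝ) : 1 + a * b ≤ √(1 + a ^ 2) * √(1 + b ^ 2) := by
  rw [← Real.sqrt_mul (by positivity)]
  exact Real.le_sqrt_of_sq_le (by nlinarith [sq_nonneg (a - b)])

lemma one_le_coshDist (x y : Hyp d) : 1 ≤ coshDist x y := by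
  obtain ⟨u, rfl⟩ := (param d).surjective x
  obtain ⟨w, rfl⟩ := (param d).surjective y
  rw [coshDist_param]
  linarith [one_add_le_sqrt_mul_sqrt ‖u‖ ‖w‖, real_inner_le_norm u w]

lemma coshDist_self (x : Hyp d) : coshDist x x = 1 := by
  rw [coshDist, x.2.1, neg_neg]

lemma one_lt_coshDist {x y : Hyp d} (h : x ≠ y) : 1 < coshDist x y := by
  refine lt_of_le_of_ne (one_le_coshDist x y) fun he => h ?_
  obtain ⟨u, rfl⟩ := (param d).surjective x
  obtain ⟨w, rfl⟩ := (param d).surjective y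
  rw [coshDist_param] at he
  have hin := real_inner_le_norm u w
  have h1 : √(1 + ‖u‖ ^ 2) * √(1 + ‖w‖ ^ 2) ≤ 1 + ‖u‖ * ‖w‖ := by linarith
  -- Both inequalities behind `one_le_coshDist` are equalities: the first gives parallel vectors,
  -- the second equal norms.
  have h2 : inner ℝ u w = ‖u‖ * ‖w‖ := by linarith [one_add_le_sqrt_mul_sqrt ‖u‖ ‖w‖]
  have h3 : ‖u‖ = ‖w‖ := by
    rw [← Real.sqrt_mul (by positivity), Real.sqrt_le_iff] at h1
    have : (‖u‖ - ‖w‖) ^ 2 ≤ 0 := by nlinarith [h1.2]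
    exact sub_eq_zero.1 (pow_eq_zero_iff two_ne_zero |>.1 (le_antisymm this (sq_nonneg _)))
  have h4 : ‖u - w‖ ^ 2 = 0 := by
    rw [norm_sub_sq_real, h2, h3]; ring
  rw [pow_eq_zero_iff two_ne_zero, norm_eq_zero, sub_eq_zero] at h4
  rw [h4]

lemma norm_lt_sqrt (u : Coord d) : ‖u‖ < √(1 + ‖u‖ ^ 2) :=
  Real.lt_sqrt_of_sq_lt (by linarith)

lemma coshDist_le (x y : Hyp d) : coshDist x y ≤ 2 * height x * height y := by
  obtain ⟨u, rfl⟩ := (param d).surjective x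
  obtain ⟨w, rfl⟩ := (param d).surjective y
  rw [coshDist_param, height_param, height_param]
  have h1 := (abs_le.1 (abs_real_inner_le_norm u w)).1
  have h2 : ‖u‖ * ‖w‖ ≤ √(1 + ‖u‖ ^ 2) * √(1 + ‖w‖ ^ 2) :=
    mul_le_mul (norm_lt_sqrt u).le (norm_lt_sqrt w).le (norm_nonneg _) (Real.sqrt_nonneg _)
  linarith

/-- With `a`, `b` the heights of `x = (u, a)` and `y = (w, b)`, `coshDist x y ≥ a (b - ‖w‖)`, and
`b² - ‖w‖² = 1` gives `b - ‖w‖ = 1 / (b + ‖w‖) ≥ 1 / (2b)`. With `coshDist_le`, distances to a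
bounded set are controlled by the height alone. -/
lemma le_coshDist (x y : Hyp d) : height x / (2 * height y) ≤ coshDist x y := by
  obtain ⟨u, rfl⟩ := (param d).surjective x
  obtain ⟨w, rfl⟩ := (param d).surjective y
  have hx := one_le_height (param d u)
  have hy := one_le_height (param d w)
  rw [coshDist_param]
  rw [height_param] at *
  rw [height_param] at *
  have hin := real_inner_le_norm u w
  have hu := norm_lt_sqrt u
  have hw := norm_lt_sqrt w
  have hsq : √(1 + ‖w‖ ^ 2) ^ 2 = 1 + ‖w‖ ^ 2 := Real.sq_sqrt (by positivity)
  set a := √(1 + ‖u‖ ^ 2)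
  set b := √(1 + ‖w‖ ^ 2)
  have hw0 := norm_nonneg w
  have h1 : ‖u‖ * ‖w‖ ≤ a * ‖w‖ := by gcongr
  have h2 : 1 ≤ (b - ‖w‖) * (2 * b) := by nlinarith
  rw [div_le_iff₀ (by linarith)]
  have h3 : a * (b - ‖w‖) ≤ a * b - inner ℝ u w := by linarith
  calc a ≤ a * ((b - ‖w‖) * (2 * b)) := le_mul_of_one_le_right (by linarith) h2
    _ = a * (b - ‖w‖) * (2 * b) := by ring
    _ ≤ _ := by gcongr

/-- The base point `(0, …, 0, 1)` of hyperbolic space. -/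
def origin (d : ℕ) : Hyp d := param d 0

lemma coshDist_origin (x : Hyp d) : coshDist (origin d) x = height x := by
  obtain ⟨u, rfl⟩ := (param d).surjective x
  rw [origin, coshDist_param, height_param]
  simp

lemma G_eq_kern (hd : d ≠ 0) {x y : Hyp d} (h : x ≠ y) : G x y = kern d 0 (coshDist x y) := by
  have h1 := one_lt_coshDist h
  have h2 : hdist x y = Real.arcosh (coshDist x y) := rfl
  rw [G, h2, k_eq_kern hd (Real.arcosh_pos h1), Real.cosh_arcosh h1.le]

lemma one_le_hdist {x y : Hyp d} (h : Real.cosh 1 ≤ coshDist x y) : 1 ≤ hdist x y := by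
  have h1 : 1 ≤ coshDist x y := one_le_coshDist x y
  calc (1 : ℝ) = Real.arcosh (Real.cosh 1) := (Real.arcosh_cosh (zero_le_one' ℝ)).symm
    _ ≤ Real.arcosh (coshDist x y) :=
      (Real.arcosh_le_arcosh (Real.cosh_pos 1) (by linarith)).2 h

end Mink

/-! ### Lorentz transformations preserve the volume -/

section Lorentz

variable {d : ℕ}

lemma fderiv_emb_bilin (u v w : Coord d) :
    mink (fderiv ℝ emb u v) (fderiv ℝ emb u w) = ∑ i, ∑ j, v i * metric u i j * w j := by
  have hexp : ∀ z : Coord d, fderiv ℝ emb u z = ∑ i, z i • fderiv ℝ emb u (basisVec i) := by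
    intro z
    have hz : z = ∑ i, z i • basisVec i := by
      have := (EuclideanSpace.basisFun (Fin d) ℝ).sum_repr z
      simpa using this.symm
    conv_lhs => rw [hz]
    simp
  rw [← minkForm_apply, hexp v, hexp w]
  simp only [map_sum, LinearMap.sum_apply, map_smul, LinearMap.smul_apply, minkForm_apply,
    smul_eq_mul, metric, Matrix.of_apply]
  simp only [Finset.mul_sum]
  rw [Finset.sum_comm]
  exact Finset.sum_congr rfl fun i _ => Finset.sum_congr rfl fun j _ => by ring

lemma lintegral_vol (g : Hyp d → ENNReal) (hg : Measurable g) :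
    ∫⁻ y, g y ∂vol d = ∫⁻ u, ENNReal.ofReal (density u) * g (param d u) := by
  rw [vol, lintegral_map hg (param d).measurable]
  exact lintegral_withDensity_eq_lintegral_mul _
    contDiff_density.continuous.measurable.ennreal_ofReal (hg.comp (param d).measurable)

/-- If a coordinate map is the expression of a Lorentz transformation, its Jacobian compensates
the change of the volume density. -/
lemma abs_det_mul_density (L : Mink d →L[ℝ] Mink d) (hL : ∀ y z, mink (L y) (L z) = mink y z)
    {τ : Coord d → Coord d} (hτ : Differentiable ℝ τ) (hemb : ∀ u, emb (τ u) = L (emb u))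
    (u : Coord d) : |(fderiv ℝ τ u).det| * density (τ u) = density u := by
  have hE : Differentiable ℝ (emb (d := d)) := contDiff_emb.differentiable (by simp)
  have hchain : ∀ v, fderiv ℝ emb (τ u) (fderiv ℝ τ u v) = L (fderiv ℝ emb u v) := by
    intro v
    have h1 := (hE (τ u)).hasFDerivAt.comp u (hτ u).hasFDerivAt
    have h2 := L.hasFDerivAt.comp u (hE u).hasFDerivAt
    have h3 : emb ∘ τ = L ∘ emb := funext hemb
    rw [h3] at h1
    exact DFunLike.congr_fun (h1.unique h2) v
  let J : Matrix (Fin d) (Fin d) ℝ := Matrix.of fun i j => fderiv ℝ τ u (basisVec j) i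
  -- Invariance of the Minkowski form says that `τ` is an isometry of the metric; determinants then
  -- give the claim.
  have hJ : metric u = J.transpose * metric (τ u) * J := by
    ext i j
    have h1 : metric u i j = mink (fderiv ℝ emb u (basisVec i)) (fderiv ℝ emb u (basisVec j)) := rfl
    rw [h1, ← hL, ← hchain, ← hchain, fderiv_emb_bilin, Matrix.mul_apply]
    simp only [Matrix.mul_apply, Finset.sum_mul]
    rw [Finset.sum_comm]
    rfl
  have hdet : (fderiv ℝ τ u).det = J.det := by
    rw [ContinuousLinearMap.det, ← LinearMap.det_toMatrix (EuclideanSpace.basisFun (Fin d) ℝ).toBasis]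
    congr 1
  rw [hdet, density, density, hJ, Matrix.det_mul, Matrix.det_mul, Matrix.det_transpose,
    show J.det * (metric (τ u)).det * J.det = J.det ^ 2 * (metric (τ u)).det by ring,
    Real.sqrt_mul (sq_nonneg _), Real.sqrt_sq_eq_abs]

lemma measurePreserving_of_lorentz (L : Mink d →L[ℝ] Mink d)
    (hL : ∀ y z, mink (L y) (L z) = mink y z) (T : Hyp d → Hyp d) (hT : T.Bijective)
    (hTL : ∀ y, (T y).1 = L y.1) : MeasurePreserving T (vol d) (vol d) := by
  have hTc : Continuous T := by
    refine Topology.IsInducing.subtypeVal.continuous_iff.2 ?_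
    exact (L.continuous.comp continuous_subtype_val).congr fun y => (hTL y).symm
  let τ : Coord d → Coord d := fun u => (param d).symm (T (param d u))
  have hpar : ∀ u, param d (τ u) = T (param d u) := fun u => (param d).apply_symm_apply _
  have hemb : ∀ u, emb (τ u) = L (emb u) := fun u => by
    rw [emb_param_symm, hTL]; rfl
  have hτ : Differentiable ℝ τ := by
    rw [differentiable_euclidean]
    intro i
    have : (fun u => τ u i) = fun u => L (emb u) i.castSucc := by
      funext u; rw [← hemb, emb_castSucc]
    rw [this]
    have hE : Differentiable ℝ (emb (d := d)) := contDiff_emb.differentiable (by simp)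
    exact (differentiable_euclidean.1 (L.differentiable.comp hE)) _
  have hbij : τ.Bijective := (param d).symm.bijective.comp (hT.comp (param d).bijective)
  refine ⟨hTc.measurable, Measure.ext_of_lintegral _ fun g hg => ?_⟩
  rw [lintegral_map hg hTc.measurable, lintegral_vol (fun y => g (T y)) (hg.comp hTc.measurable),
    lintegral_vol _ hg]
  have h := lintegral_image_eq_lintegral_abs_det_fderiv_mul volume MeasurableSet.univ
    (fun u _ => (hτ u).hasFDerivAt.hasFDerivWithinAt) hbij.injective.injOn
    (fun v => ENNReal.ofReal (density v) * g (param d v))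
  rw [image_univ, hbij.surjective.range_eq] at h
  simp only [Measure.restrict_univ] at h
  rw [h]
  refine lintegral_congr fun u => ?_
  rw [← mul_assoc, ← ENNReal.ofReal_mul (abs_nonneg _), abs_det_mul_density L hL hτ hemb, hpar]

/-- Every point is the image of the origin under a volume and distance preserving map. -/
lemma exists_lorentz (x : Hyp d) : ∃ T : Hyp d → Hyp d, MeasurePreserving T (vol d) (vol d) ∧
    Continuous T ∧ T (origin d) = x ∧ ∀ y z, coshDist (T y) (T z) = coshDist y z := by
  by_cases hx : x = origin d
  · exact ⟨id, .id _, continuous_id, hx.symm, fun _ _ => rfl⟩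
  -- The map is the Lorentz reflection `y ↦ y - 2 (⟨n, y⟩ / ⟨n, n⟩) n` with `n = x - o`, which swaps
  -- `o` and `x`. As `⟨n, n⟩ = 2m`, the coefficient is `m⁻¹ ⟨n, y⟩`.
  set m := coshDist x (origin d) - 1 with hm
  have hm0 : 0 < m := by have := one_lt_coshDist hx; linarith
  set n : Mink d := x.1 - (origin d).1 with hn
  have hxo : mink x.1 (origin d).1 = -(m + 1) := by rw [hm, coshDist]; ring
  have hxx : mink x.1 x.1 = -1 := x.2.1
  have hoo : mink (origin d).1 (origin d).1 = -1 := (origin d).2.1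
  let A : Mink d →ₗ[ℝ] Mink d :=
    LinearMap.id - (m⁻¹ • (minkForm d n)).smulRight n
  let L : Mink d →L[ℝ] Mink d := LinearMap.toContinuousLinearMap A
  have hLapp : ∀ y, L y = y - (m⁻¹ * mink n y) • n := fun y => by
    simp [L, A, minkForm_apply]
  have hnn : minkForm d n n = 2 * m := by
    rw [hn]
    simp only [map_sub, LinearMap.sub_apply, minkForm_apply, mink_comm (origin d).1 x.1, hxo, hxx,
      hoo]
    ring
  have hL : ∀ y z, mink (L y) (L z) = mink y z := by
    intro y z
    rw [← minkForm_apply, hLapp, hLapp]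
    simp only [map_sub, LinearMap.sub_apply, map_smul, LinearMap.smul_apply, hnn, smul_eq_mul]
    simp only [minkForm_apply, mink_comm y n]
    field_simp
    ring
  have hLL : ∀ y, L (L y) = y := by
    intro y
    rw [hLapp (L y), hLapp y, ← minkForm_apply n (y - _)]
    simp only [map_sub, map_smul, hnn, smul_eq_mul, minkForm_apply]
    rw [sub_sub, ← add_smul]
    have : m⁻¹ * mink n y + m⁻¹ * (mink n y - m⁻¹ * mink n y * (2 * m)) = 0 := by
      field_simp; ring
    rw [this, zero_smul, sub_zero]
  have hLo : L (origin d).1 = x.1 := by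
    have h1 : mink n (origin d).1 = -m := by
      rw [← minkForm_apply, hn]
      simp only [map_sub, LinearMap.sub_apply, minkForm_apply, hxo, hoo]
      ring
    rw [hLapp, h1, mul_neg, inv_mul_cancel₀ hm0.ne', hn]
    simp
  have hlast : ∀ y : Mink d, y (Fin.last d) = -mink (origin d).1 y := by
    intro y
    have : (origin d).1 = emb 0 := rfl
    simp [mink, this]
  have hmem : ∀ y : Hyp d, mink (L y.1) (L y.1) = -1 ∧ 0 < L y.1 (Fin.last d) := by
    intro y
    refine ⟨(hL _ _).trans y.2.1, ?_⟩
    -- The last coordinate of `L y` is `-⟨o, L y⟩ = -⟨L o, y⟩ = -⟨x, y⟩ ≥ 1`, so the future sheet is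
    -- preserved.
    rw [hlast, ← hLL (origin d).1, hL, hLo]
    exact zero_lt_one.trans_le (one_le_coshDist x y)
  let T : Hyp d → Hyp d := fun y => ⟨L y.1, hmem y⟩
  have hinv : Function.Involutive T := fun y => Subtype.ext (hLL y.1)
  refine ⟨T, measurePreserving_of_lorentz L hL T hinv.bijective fun _ => rfl, ?_,
    Subtype.ext hLo, fun y z => by simp [coshDist, T, hL]⟩
  exact (L.continuous.comp continuous_subtype_val).subtype_mk _

end Lorentz

/-! ### Integration on hyperbolic space -/

section Volume

variable {d : ℕ}

lemma density_eq (u : Coord d) : density u = (√(1 + ‖u‖ ^ 2))⁻¹ := by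
  rw [density, det_metric, Real.sqrt_inv]

lemma density_le_one (u : Coord d) : density u ≤ 1 := by
  rw [density_eq]
  exact inv_le_one_of_one_le₀ (Real.one_le_sqrt.2 (by nlinarith [sq_nonneg ‖u‖]))

lemma measurable_ofReal_density :
    Measurable fun u : Coord d => ENNReal.ofReal (density u) :=
  contDiff_density.continuous.measurable.ennreal_ofReal

lemma integral_vol (g : Hyp d → ℝ) :
    ∫ y, g y ∂vol d = ∫ u, density u * g (param d u) := by
  rw [vol, (param d).measurableEmbedding.integral_map,
    integral_withDensity_eq_integral_toReal_smul measurable_ofReal_density (by simp)]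
  exact integral_congr_ae (.of_forall fun u => by
    simp [ENNReal.toReal_ofReal (density_pos u).le])

lemma integrable_vol_iff (g : Hyp d → ℝ) :
    Integrable g (vol d) ↔ Integrable fun u => density u * g (param d u) := by
  rw [vol, (param d).measurableEmbedding.integrable_map_iff,
    integrable_withDensity_iff_integrable_smul' measurable_ofReal_density (by simp)]
  refine integrable_congr (.of_forall fun u => ?_)
  simp [ENNReal.toReal_ofReal (density_pos u).le]

instance : SFinite (vol d) := by unfold vol; infer_instance

lemma isCompact_height_le (R : ℝ) : IsCompact {x : Hyp d | height x ≤ R} := by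
  have h : IsCompact (param d '' Metric.closedBall 0 R) :=
    (isCompact_closedBall 0 R).image (param d).continuous
  refine h.of_isClosed_subset (isClosed_le continuous_height continuous_const) fun x hx => ?_
  obtain ⟨u, rfl⟩ := (param d).surjective x
  refine ⟨u, ?_, rfl⟩
  rw [mem_ofPred_eq, height_param] at hx
  simpa using (norm_lt_sqrt u).le.trans hx

lemma exists_height_le {K : Set (Hyp d)} (hK : IsCompact K) : ∃ R, 1 ≤ R ∧ ∀ x ∈ K, height x ≤ R := by
  obtain ⟨R, hR⟩ := (hK.bddAbove_image continuous_height.continuousOn)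
  exact ⟨max 1 R, le_max_left _ _, fun x hx => (hR (mem_image_of_mem _ hx)).trans (le_max_right _ _)⟩

instance : IsFiniteMeasureOnCompacts (vol d) where
  lt_top_of_isCompact K hK := by
    have hK' : IsCompact (param d ⁻¹' K) := (param d).isCompact_preimage.2 hK
    rw [vol, (param d).measurableEmbedding.map_apply]
    calc (volume.withDensity fun u : Coord d => ENNReal.ofReal (density u)) (param d ⁻¹' K)
        ≤ (volume.withDensity fun _ : Coord d => 1) (param d ⁻¹' K) := by
          refine withDensity_mono (.of_forall fun u => ?_) _
          exact ENNReal.ofReal_le_one.2 (density_le_one u)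
      _ < ⊤ := by
          have h1 : (fun _ : Coord d => (1 : ENNReal)) = 1 := rfl
          rw [h1, withDensity_one]
          exact hK'.measure_lt_top

lemma nullSingletonClass_vol (hd : d ≠ 0) : NullSingletonClass (vol d) := by
  have : Nonempty (Fin d) := ⟨⟨0, Nat.pos_of_ne_zero hd⟩⟩
  refine ⟨fun x => ?_⟩
  obtain ⟨u, rfl⟩ := (param d).surjective x
  rw [vol, (param d).measurableEmbedding.map_apply, ← image_singleton,
    (param d).injective.preimage_image]
  exact withDensity_absolutelyContinuous _ _ (measure_singleton u)

/-! ### Measurability, local integrability and decay of the kernel. -/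

lemma measurable_tail (d : ℕ) (δ : ℝ) : Measurable (tail d δ) := by
  have h : tail d δ = fun c => ∫ s, (Ioi c).indicator (tailDensity d δ) s := by
    funext c; exact (integral_indicator measurableSet_Ioi).symm
  rw [h]
  refine StronglyMeasurable.measurable (StronglyMeasurable.integral_prod_right
    (f := fun c s => (Ioi c).indicator (tailDensity d δ) s) ?_)
  have : (Function.uncurry fun c s => (Ioi c).indicator (tailDensity d δ) s) =
      {p : ℝ × ℝ | p.1 < p.2}.indicator fun p => tailDensity d δ p.2 := by
    funext p; simp [Function.uncurry, indicator]
  rw [this]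
  exact (((measurable_tailDensity d δ).comp measurable_snd).indicator
    (measurableSet_lt measurable_fst measurable_snd)).stronglyMeasurable

lemma measurable_kern (d : ℕ) (δ : ℝ) : Measurable (kern d δ) :=
  (measurable_id.div_const _).mul (measurable_tail d δ).neg

lemma abs_kern (hd : d ≠ 0) {δ c : ℝ} (hc : 0 ≤ c) :
    |kern d δ c| = c / sphereArea d * tail d δ c := by
  have := sphereArea_pos hd
  rw [kern, mul_neg, abs_neg, abs_of_nonneg (mul_nonneg (by positivity) (tail_nonneg d δ c))]

lemma measurable_kern_coshDist (δ : ℝ) (x : Hyp d) :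
    Measurable fun y => kern d δ (coshDist x y) :=
  (measurable_kern d δ).comp
    (continuous_coshDist.comp (by fun_prop : Continuous fun y : Hyp d => (x, y))).measurable

lemma measurable_coshDist (x : Hyp d) : Measurable fun y => coshDist x y :=
  (continuous_coshDist.comp (by fun_prop : Continuous fun y : Hyp d => (x, y))).measurable

/-- In the global chart `‖u‖ = sinh ρ`, so `tail_zero_le_near` bounds the kernel by a multiple of
`‖u‖^{1-d}`, whose singularity is cancelled by the polar Jacobian `r^{d-1}`. -/
lemma integrableOn_kern_height (hd : d ≠ 0) (R : ℝ) :
    IntegrableOn (fun y => kern d 0 (height y)) {y : Hyp d | height y ≤ R} (vol d) := by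
  obtain ⟨n, rfl⟩ := Nat.exists_eq_succ_of_ne_zero hd
  have hv := sphereArea_pos hd
  have hmeas : MeasurableSet {y : Hyp (n + 1) | height y ≤ R} :=
    (isCompact_height_le R).isClosed.measurableSet
  rw [← integrable_indicator_iff hmeas, integrable_vol_iff]
  have hdom : IntegrableOn (fun u : Coord (n + 1) => R / sphereArea (n + 1) * (‖u‖ ^ n)⁻¹)
      (Metric.ball 0 R) := by
    refine Integrable.const_mul ?_ _
    rw [← IntegrableOn, integrableOn_fun_norm_addHaar volume (f := fun r => (r ^ n)⁻¹)]
    refine (integrableOn_const (C := (1 : ℝ)) (by simp)).congr_fun (fun r hr => ?_)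
      measurableSet_Ioo
    have : 0 < r := hr.1
    simp only [finrank_euclideanSpace, Fintype.card_fin, Nat.add_sub_cancel, smul_eq_mul]
    field_simp
  rw [← integrable_indicator_iff measurableSet_ball] at hdom
  refine hdom.mono' ?_ ?_
  · refine (contDiff_density.continuous.measurable.mul ?_).aestronglyMeasurable
    exact (((measurable_kern _ 0).comp continuous_height.measurable).indicator hmeas).comp
      (param _).measurable
  · have h0 : ∀ᵐ u : Coord (n + 1), u ≠ 0 := by simp [ae_iff]
    filter_upwards [h0] with u hu
    have hu0 : 0 < ‖u‖ := norm_pos_iff.2 hu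
    by_cases h : height (param (n + 1) u) ≤ R
    · have hball : u ∈ Metric.ball (0 : Coord (n + 1)) R := by
        rw [height_param] at h
        simpa using (norm_lt_sqrt u).trans_le h
      rw [indicator_of_mem (by exact h), indicator_of_mem hball, norm_mul,
        Real.norm_of_nonneg (density_pos u).le, Real.norm_eq_abs]
      refine (mul_le_of_le_one_left (abs_nonneg _) (density_le_one u)).trans ?_
      have h1 := one_le_height (param (n + 1) u)
      rw [abs_kern hd (by linarith)]
      have hlt : 1 < height (param (n + 1) u) := by
        rw [height_param, Real.lt_sqrt (by norm_num)]
        nlinarith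
      have hsq : √(height (param (n + 1) u) ^ 2 - 1) = ‖u‖ := by
        rw [height_param, Real.sq_sqrt (by positivity)]
        simp
      have := tail_zero_le_near n hlt
      rw [hsq] at this
      have hR : 0 ≤ R := by linarith
      have h3 := tail_nonneg (n + 1) 0 (height (param (n + 1) u))
      gcongr
    · rw [indicator_of_notMem (by exact h)]
      simp only [mul_zero, norm_zero]
      refine indicator_nonneg (fun w hw => ?_) _
      have : 0 ≤ R := (norm_nonneg w).trans (by simpa using (mem_ball_zero_iff.1 hw).le)
      positivity

/-- The mass of the kernel on the hyperbolic balls `{cosh ρ ≤ R}` about the base point. -/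
def kernMass (d : ℕ) (R : ℝ) : ℝ :=
  ∫ y, {y : Hyp d | height y ≤ R}.indicator (fun y => |kern d 0 (height y)|) y ∂vol d

lemma kernMass_nonneg (d : ℕ) (R : ℝ) : 0 ≤ kernMass d R :=
  integral_nonneg fun _ => indicator_nonneg (fun _ _ => abs_nonneg _) _

/-- A Lorentz transformation carries the ball about the origin to the ball about `x`. The
independence of `x` makes the bound in `exists_setIntegral_kern_le` uniform for `x` of bounded
height. -/
lemma integrable_kern_ball (hd : d ≠ 0) (x : Hyp d) (R : ℝ) :
    Integrable ({y | coshDist x y ≤ R}.indicator fun y => |kern d 0 (coshDist x y)|) (vol d) ∧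
    ∫ y, {y | coshDist x y ≤ R}.indicator (fun y => |kern d 0 (coshDist x y)|) y ∂vol d =
      kernMass d R := by
  obtain ⟨T, hT, -, hTo, hTd⟩ := exists_lorentz x
  have hm : Measurable ({y | coshDist x y ≤ R}.indicator fun y => |kern d 0 (coshDist x y)|) :=
    (measurable_kern_coshDist 0 x).abs.indicator
      (measurableSet_le (measurable_coshDist x) measurable_const)
  have hcomp : ({y | coshDist x y ≤ R}.indicator fun y => |kern d 0 (coshDist x y)|) ∘ T =
      {y | height y ≤ R}.indicator fun y => |kern d 0 (height y)| := by
    funext y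
    have : coshDist x (T y) = height y := by rw [← coshDist_origin, ← hTd (origin d), hTo]
    simp [indicator, this]
  constructor
  · rw [← hT.integrable_comp hm.aestronglyMeasurable, hcomp,
      integrable_indicator_iff (isCompact_height_le R).isClosed.measurableSet]
    exact Integrable.abs (integrableOn_kern_height hd R)
  · rw [kernMass, ← hcomp]
    conv_lhs => rw [← hT.map_eq]
    rw [integral_map hT.aemeasurable hm.aestronglyMeasurable]
    rfl

lemma integrableOn_kern (hd : d ≠ 0) (x : Hyp d) (R : ℝ) :
    IntegrableOn (fun y => |kern d 0 (coshDist x y)|) {y | height y ≤ R} (vol d) := by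
  have h := (integrable_kern_ball hd x (2 * height x * R)).1
  rw [integrable_indicator_iff (measurableSet_le (measurable_coshDist x) measurable_const)] at h
  refine h.mono_set fun y hy => (coshDist_le x y).trans ?_
  have := one_le_height x
  have hy' : height y ≤ R := hy
  gcongr

/-- Potentials of densities supported in a fixed ball decay like `(cosh ρ)^{-d}`. -/
lemma exists_setIntegral_kern_le (hd : d ≠ 0) {R : ℝ} (hR : 1 ≤ R) :
    ∃ C, 0 ≤ C ∧ ∀ x : Hyp d,
      ∫ y in {y | height y ≤ R}, |kern d 0 (coshDist x y)| ∂vol d ≤ C * (height x ^ d)⁻¹ := by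
  have hv := sphereArea_pos hd
  have hmeas : MeasurableSet {y : Hyp d | height y ≤ R} :=
    (isCompact_height_le R).isClosed.measurableSet
  -- `C₁` serves `height x ≤ 4R`: by `coshDist_le` the domain lies in a ball of cosh-radius `2 (4R)
  -- R` about `x`, and `(4R)^d` compensates `height x ^ (-d)`. `C₂` serves the other points.
  set C₁ := kernMass d (2 * (4 * R) * R) * (4 * R) ^ d
  set C₂ := (vol d).real {y | height y ≤ R} * (2 ^ d / sphereArea d * (2 * R) ^ d)
  have hC₁ : 0 ≤ C₁ := mul_nonneg (kernMass_nonneg _ _) (by positivity)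
  have hC₂ : 0 ≤ C₂ := by positivity
  refine ⟨C₁ + C₂, by positivity, fun x => ?_⟩
  have hx := one_le_height x
  by_cases h : height x ≤ 4 * R
  · have h1 : ∫ y in {y | height y ≤ R}, |kern d 0 (coshDist x y)| ∂vol d ≤
        kernMass d (2 * (4 * R) * R) := by
      obtain ⟨hi, he⟩ := integrable_kern_ball hd x (2 * (4 * R) * R)
      rw [← he, ← integral_indicator hmeas]
      refine integral_mono ((integrableOn_kern hd x R).integrable_indicator hmeas) hi fun y => ?_
      refine indicator_le_indicator_of_subset (fun y hy => ?_) (fun _ => abs_nonneg _) y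
      have hy' : height y ≤ R := hy
      refine (coshDist_le x y).trans ?_
      have := one_le_height y
      gcongr
    refine h1.trans ?_
    rw [add_mul]
    have h2 : kernMass d (2 * (4 * R) * R) ≤ C₁ * (height x ^ d)⁻¹ := by
      simp only [C₁]
      rw [mul_assoc (kernMass _ _)]
      refine le_mul_of_one_le_right (kernMass_nonneg _ _) ?_
      rw [← div_eq_mul_inv, ← div_pow]
      exact one_le_pow₀ ((one_le_div (by linarith)).2 h)
    have : 0 ≤ C₂ * (height x ^ d)⁻¹ := by positivity
    linarith
  -- Beyond `4R` the bound `coshDist x y ≥ height x / (2R)` exceeds 2, the range of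
  -- `tail_zero_le_far`.
  · push Not at h
    have hpt : ∀ y ∈ {y : Hyp d | height y ≤ R}, |kern d 0 (coshDist x y)| ≤
        2 ^ d / sphereArea d * (2 * R) ^ d * (height x ^ d)⁻¹ := by
      intro y hy
      have hy' : height y ≤ R := hy
      have hy1 := one_le_height y
      have hc : height x / (2 * R) ≤ coshDist x y := by
        refine le_trans ?_ (le_coshDist x y)
        gcongr
      have hc2 : 2 ≤ coshDist x y := by
        refine le_trans ?_ hc
        rw [le_div_iff₀ (by linarith)]
        linarith
      have hc0 : 0 < coshDist x y := by linarith
      rw [abs_kern hd hc0.le]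
      calc coshDist x y / sphereArea d * tail d 0 (coshDist x y)
          ≤ coshDist x y / sphereArea d * (2 ^ d * (coshDist x y ^ (d + 1))⁻¹) := by
            have := tail_zero_le_far d hc2
            gcongr
        _ = 2 ^ d / sphereArea d * (coshDist x y ^ d)⁻¹ := by
            rw [pow_succ]
            field_simp
        _ ≤ 2 ^ d / sphereArea d * ((height x / (2 * R)) ^ d)⁻¹ := by
            have : 0 < height x / (2 * R) := by positivity
            gcongr
        _ = _ := by
            rw [div_pow]
            field_simp
    have hfin : vol d {y | height y ≤ R} < ⊤ := (isCompact_height_le R).measure_lt_top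
    calc ∫ y in {y | height y ≤ R}, |kern d 0 (coshDist x y)| ∂vol d
        ≤ ∫ y in {y | height y ≤ R}, 2 ^ d / sphereArea d * (2 * R) ^ d * (height x ^ d)⁻¹ ∂vol d :=
          setIntegral_mono_on (integrableOn_kern hd x R) (integrableOn_const hfin.ne) hmeas hpt
      _ = C₂ * (height x ^ d)⁻¹ := by
          rw [setIntegral_const, smul_eq_mul]; ring
      _ ≤ _ := by gcongr; linarith

/-- The decay condition says that `(cosh ρ)^{-d}` is integrable. -/
lemma integrable_height_inv (hd : d ≠ 0) {μ : Measure (Hyp d)} [IsFiniteMeasureOnCompacts μ]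
    (hμ : DecayCondition μ) : Integrable (fun x => (height x ^ d)⁻¹) μ := by
  obtain ⟨x₀, h₀⟩ := hμ
  have hv := sphereArea_pos hd
  have hx₀ := one_le_height x₀
  have hcont : Continuous fun x : Hyp d => (height x ^ d)⁻¹ :=
    (continuous_height.pow d).inv₀ fun x =>
      pow_ne_zero d (zero_lt_one.trans_le (one_le_height x)).ne'
  -- Chosen so that `height x > r` forces `cosh d(x₀, x) ≥ cosh 1` through `le_coshDist`. On the
  -- compact set `height x ≤ r`, local finiteness of `μ` suffices.
  set r := 2 * height x₀ * Real.cosh 1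
  have hK := isCompact_height_le (d := d) r
  have hKm := hK.isClosed.measurableSet
  rw [← integrableOn_univ, ← union_compl_self {x : Hyp d | height x ≤ r}]
  refine (hcont.continuousOn.integrableOn_compact hK).union ?_
  refine ⟨hcont.aestronglyMeasurable, ?_⟩
  -- The first two factors come from `|G| ≥ c^{-d} / (v_{d-1} (d + 1))`, the last from `c ≤ 2 height
  -- x₀ · height x`.
  set C := sphereArea d * (d + 1) * (2 * height x₀) ^ d
  have hC : 0 < C := mul_pos (by positivity) (pow_pos (by linarith) d)
  have key : ∀ x : Hyp d, x ∈ {x : Hyp d | height x ≤ r}ᶜ →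
      1 ≤ hdist x₀ x ∧ (height x ^ d)⁻¹ ≤ C * |G x₀ x| := by
    intro x hx
    have hx' : r < height x := not_le.1 hx
    have h1 := one_le_height x
    have hc : Real.cosh 1 ≤ coshDist x₀ x := by
      rw [coshDist_comm]
      refine le_trans ?_ (le_coshDist x x₀)
      rw [le_div_iff₀ (by linarith)]
      linarith
    have hc1 : 1 < coshDist x₀ x := (Real.one_lt_cosh.2 one_ne_zero).trans_le hc
    have hne : x₀ ≠ x := by
      rintro rfl
      rw [coshDist_self] at hc1
      exact lt_irrefl _ hc1
    refine ⟨one_le_hdist hc, ?_⟩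
    have hc0 : 0 < coshDist x₀ x := by linarith
    rw [G_eq_kern hd hne, abs_kern hd hc0.le]
    calc (height x ^ d)⁻¹ = (2 * height x₀) ^ d * ((2 * height x₀ * height x) ^ d)⁻¹ := by
          rw [mul_pow (2 * height x₀)]
          field_simp
      _ ≤ (2 * height x₀) ^ d * (coshDist x₀ x ^ d)⁻¹ := by
          have := coshDist_le x₀ x
          gcongr
      _ = C * (coshDist x₀ x / sphereArea d * ((coshDist x₀ x ^ (d + 1))⁻¹ / (d + 1))) := by
          simp only [C, pow_succ]
          field_simp
      _ ≤ _ := by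
          have := le_tail_zero d hc1
          gcongr
  have hle : ∫⁻ x in {x : Hyp d | height x ≤ r}ᶜ, ‖(height x ^ d)⁻¹‖ₑ ∂μ ≤
      ENNReal.ofReal C * ∫⁻ y in {y | 1 ≤ hdist x₀ y}, ENNReal.ofReal |G x₀ y| ∂μ := by
    rw [← lintegral_const_mul' _ _ ENNReal.ofReal_ne_top]
    refine le_trans ?_ (lintegral_mono_set (fun x hx => (key x hx).1))
    refine setLIntegral_mono' hKm.compl fun x hx => ?_
    have h1 := one_le_height x
    rw [← ENNReal.ofReal_mul hC.le, Real.enorm_of_nonneg (by positivity)]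
    exact ENNReal.ofReal_le_ofReal (key x hx).2
  exact hle.trans_lt (ENNReal.mul_lt_top ENNReal.ofReal_lt_top h₀)

end Volume

/-! ### Green's formula for radial functions -/

section Green

variable {d : ℕ}

/-- The hyperbolic cosine of the distance to `param d w`, in coordinates. -/
def coordDist (w u : Coord d) : ℝ := √(1 + ‖w‖ ^ 2) * √(1 + ‖u‖ ^ 2) - inner ℝ w u

lemma coshDist_param' (w u : Coord d) : coshDist (param d w) (param d u) = coordDist w u :=
  coshDist_param w u

lemma one_le_coordDist (w u : Coord d) : 1 ≤ coordDist w u := by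
  rw [← coshDist_param']; exact one_le_coshDist _ _

lemma continuous_coordDist (w : Coord d) : Continuous (coordDist w) := by
  unfold coordDist; fun_prop

lemma hasFDerivAt_sqrt_one_add (u : Coord d) :
    HasFDerivAt (fun v : Coord d => √(1 + ‖v‖ ^ 2))
      ((√(1 + ‖u‖ ^ 2))⁻¹ • innerSL ℝ u) u := by
  have hpos : (0 : ℝ) < 1 + ‖u‖ ^ 2 := by positivity
  refine (((hasStrictFDerivAt_norm_sq u).hasFDerivAt.const_add 1).sqrt hpos.ne').congr_fderiv ?_
  ext v
  simp
  field_simp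

lemma hasFDerivAt_coordDist (w u : Coord d) :
    HasFDerivAt (coordDist w)
      ((√(1 + ‖w‖ ^ 2) * (√(1 + ‖u‖ ^ 2))⁻¹) • innerSL ℝ u - innerSL ℝ w) u := by
  refine (((hasFDerivAt_sqrt_one_add u).const_mul (√(1 + ‖w‖ ^ 2))).sub
    (innerSL ℝ w).hasFDerivAt).congr_fderiv ?_
  rw [smul_smul]

/-- The components of `√(det g) ∇(φ ∘ c)`. -/
def radialField (φ' : ℝ → ℝ) (w : Coord d) (j : Fin d) (u : Coord d) : ℝ :=
  (√(1 + ‖u‖ ^ 2))⁻¹ * (φ' (coordDist w u) * (coordDist w u * u j - w j))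

lemma fderiv_radialField {φ' : ℝ → ℝ} {m : ℝ} (w u : Coord d) (j : Fin d)
    (h : HasDerivAt φ' m (coordDist w u)) :
    DifferentiableAt ℝ (radialField φ' w j) u ∧
      fderiv ℝ (radialField φ' w j) u (basisVec j) = (√(1 + ‖u‖ ^ 2))⁻¹ *
        (m * ((√(1 + ‖w‖ ^ 2) * (√(1 + ‖u‖ ^ 2))⁻¹ * u j - w j) * (coordDist w u * u j - w j)) +
          φ' (coordDist w u) *
            ((√(1 + ‖w‖ ^ 2) * (√(1 + ‖u‖ ^ 2))⁻¹ * u j - w j) * u j + coordDist w u -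
              ((√(1 + ‖u‖ ^ 2))⁻¹) ^ 2 * ((coordDist w u * u j - w j) * u j))) := by
  have hpos : √(1 + ‖u‖ ^ 2) ≠ 0 := (Real.sqrt_pos.2 (by positivity)).ne'
  have hc := hasFDerivAt_coordDist w u
  have hs := hasFDerivAt_sqrt_one_add u
  have hu : HasFDerivAt (fun v : Coord d => v j) (EuclideanSpace.proj j : Coord d →L[ℝ] ℝ) u :=
    (EuclideanSpace.proj j : Coord d →L[ℝ] ℝ).hasFDerivAt
  have h1 := (hasDerivAt_inv hpos).comp_hasFDerivAt u hs
  have h2 := h.comp_hasFDerivAt u hc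
  have h3 := (hc.mul hu).sub_const (w j)
  have h4 : HasFDerivAt (radialField φ' w j) _ u := h1.mul (h2.mul h3)
  refine ⟨h4.differentiableAt, ?_⟩
  rw [h4.fderiv]
  simp [EuclideanSpace.inner_single_right]
  ring

lemma sum_mul_eq_inner (w u : Coord d) : ∑ j, w j * u j = inner ℝ w u := by
  rw [PiLp.inner_apply]
  exact Finset.sum_congr rfl fun i _ => by simp [mul_comm]

/-- The divergence of the gradient of a radial function. -/
lemma sum_deriv_radialField (w u : Coord d) (m n : ℝ) :
    ∑ j, (√(1 + ‖u‖ ^ 2))⁻¹ *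
        (m * ((√(1 + ‖w‖ ^ 2) * (√(1 + ‖u‖ ^ 2))⁻¹ * u j - w j) * (coordDist w u * u j - w j)) +
          n * ((√(1 + ‖w‖ ^ 2) * (√(1 + ‖u‖ ^ 2))⁻¹ * u j - w j) * u j + coordDist w u -
              ((√(1 + ‖u‖ ^ 2))⁻¹) ^ 2 * ((coordDist w u * u j - w j) * u j))) =
      (√(1 + ‖u‖ ^ 2))⁻¹ *
        ((coordDist w u ^ 2 - 1) * m + d * coordDist w u * n) := by
  have hs : 0 < √(1 + ‖u‖ ^ 2) := Real.sqrt_pos.2 (by positivity)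
  have hs2 : √(1 + ‖u‖ ^ 2) ^ 2 = 1 + ‖u‖ ^ 2 := Real.sq_sqrt (by positivity)
  have ha2 : √(1 + ‖w‖ ^ 2) ^ 2 = 1 + ‖w‖ ^ 2 := Real.sq_sqrt (by positivity)
  have hcd : coordDist w u = √(1 + ‖w‖ ^ 2) * √(1 + ‖u‖ ^ 2) - inner ℝ w u := rfl
  set c := coordDist w u
  set s := √(1 + ‖u‖ ^ 2)
  set a := √(1 + ‖w‖ ^ 2)
  have hexp : ∀ j, s⁻¹ * (m * ((a * s⁻¹ * u j - w j) * (c * u j - w j)) +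
      n * ((a * s⁻¹ * u j - w j) * u j + c - s⁻¹ ^ 2 * ((c * u j - w j) * u j))) =
      (s⁻¹ * (m * a * s⁻¹ * c + n * a * s⁻¹ - n * s⁻¹ ^ 2 * c)) * (u j * u j) +
      (s⁻¹ * (-m * a * s⁻¹ - m * c - n + n * s⁻¹ ^ 2)) * (w j * u j) +
      s⁻¹ * m * (w j * w j) + s⁻¹ * n * c := fun j => by ring
  simp only [hexp, Finset.sum_add_distrib, ← Finset.mul_sum, sum_mul_self, sum_mul_eq_inner]
  simp only [Finset.sum_const, Finset.card_univ, Fintype.card_fin, nsmul_eq_mul]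
  have hp : inner ℝ w u = a * s - c := by linarith
  have hq : ‖u‖ ^ 2 = s ^ 2 - 1 := by linarith
  have hb : ‖w‖ ^ 2 = a ^ 2 - 1 := by linarith
  rw [hp, hq, hb]
  field_simp
  ring

/-- The gradient of a radial function in coordinates. -/
lemma sum_mul_metric_inv (w u : Coord d) (j : Fin d) :
    ∑ i, (√(1 + ‖w‖ ^ 2) * (√(1 + ‖u‖ ^ 2))⁻¹ * u i - w i) * (metric u)⁻¹ i j =
      coordDist w u * u j - w j := by
  have hs : 0 < √(1 + ‖u‖ ^ 2) := Real.sqrt_pos.2 (by positivity)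
  have hs2 : √(1 + ‖u‖ ^ 2) ^ 2 = 1 + ‖u‖ ^ 2 := Real.sq_sqrt (by positivity)
  have hcd : coordDist w u = √(1 + ‖w‖ ^ 2) * √(1 + ‖u‖ ^ 2) - inner ℝ w u := rfl
  set c := coordDist w u
  set s := √(1 + ‖u‖ ^ 2)
  set a := √(1 + ‖w‖ ^ 2)
  have hexp : ∀ i, (a * s⁻¹ * u i - w i) * (metric u)⁻¹ i j =
      (if i = j then a * s⁻¹ * u i - w i else 0) + a * s⁻¹ * u j * (u i * u i) -
        u j * (w i * u i) := fun i => by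
    rw [metric_inv_apply]
    split_ifs <;> ring
  simp only [hexp, Finset.sum_sub_distrib, Finset.sum_add_distrib, ← Finset.mul_sum, sum_mul_self,
    sum_mul_eq_inner]
  have hp : inner ℝ w u = a * s - c := by linarith
  have hq : ‖u‖ ^ 2 = s ^ 2 - 1 := by linarith
  rw [hp, hq]
  simp
  field_simp
  ring

lemma contDiff_flux {F : Coord d → ℝ} (hF : ContDiff ℝ ∞ F) (i : Fin d) :
    ContDiff ℝ ∞ fun v => density v * ∑ j, (metric v)⁻¹ i j * fderiv ℝ F v (basisVec j) :=
  contDiff_density.mul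
    (ContDiff.sum fun j _ => (contDiff_metric_inv i j).mul (contDiff_fderiv_basisVec hF j))

lemma hasCompactSupport_flux {F : Coord d → ℝ} (hF : HasCompactSupport F) (i : Fin d) :
    HasCompactSupport fun v =>
      density v * ∑ j, (metric v)⁻¹ i j * fderiv ℝ F v (basisVec j) := by
  refine hF.mono' fun v hv => ?_
  by_contra h
  refine hv ?_
  have : fderiv ℝ F v = 0 := by
    by_contra h'
    exact h (support_fderiv_subset ℝ h')
  simp [this]

/-- Green's formula for a radial function and a test function. -/
lemma integral_radial_mul_coordLaplacian {φ φ' φ'' : ℝ → ℝ}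
    (hφ : ∀ c, 1 ≤ c → HasDerivAt φ (φ' c) c) (hφ' : ∀ c, 1 ≤ c → HasDerivAt φ' (φ'' c) c)
    (hφ'' : ContinuousOn φ'' (Ici 1)) (w : Coord d) {F : Coord d → ℝ} (hF : ContDiff ℝ ∞ F)
    (hFc : HasCompactSupport F) :
    ∫ u, density u * (φ (coordDist w u) * coordLaplacian F u) =
      ∫ u, density u * (((coordDist w u ^ 2 - 1) * φ'' (coordDist w u) +
        d * coordDist w u * φ' (coordDist w u)) * F u) := by
  set X : Fin d → Coord d → ℝ := fun i v =>
    density v * ∑ j, (metric v)⁻¹ i j * fderiv ℝ F v (basisVec j) with hX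
  have hXs : ∀ i, ContDiff ℝ ∞ (X i) := contDiff_flux hF
  have hXc : ∀ i, HasCompactSupport (X i) := hasCompactSupport_flux hFc
  have hXd : ∀ i, Continuous fun u => fderiv ℝ (X i) u (basisVec i) := fun i =>
    (contDiff_fderiv_basisVec (hXs i) i).continuous
  have hXdc : ∀ i, HasCompactSupport fun u => fderiv ℝ (X i) u (basisVec i) := fun i =>
    (hXc i).fderiv_apply ℝ (basisVec i)
  have hFd : ∀ i, Continuous fun u => fderiv ℝ F u (basisVec i) := fun i =>
    (contDiff_fderiv_basisVec hF i).continuous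
  have hFdc : ∀ i, HasCompactSupport fun u => fderiv ℝ F u (basisVec i) := fun i =>
    hFc.fderiv_apply ℝ (basisVec i)
  have hc := continuous_coordDist w
  have hΦ : ∀ u, HasFDerivAt (fun u => φ (coordDist w u)) (φ' (coordDist w u) •
      ((√(1 + ‖w‖ ^ 2) * (√(1 + ‖u‖ ^ 2))⁻¹) • innerSL ℝ u - innerSL ℝ w)) u := fun u =>
    (hφ _ (one_le_coordDist w u)).comp_hasFDerivAt u (hasFDerivAt_coordDist w u)
  have hΦd : ∀ u i, fderiv ℝ (fun u => φ (coordDist w u)) u (basisVec i) =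
      φ' (coordDist w u) * (√(1 + ‖w‖ ^ 2) * (√(1 + ‖u‖ ^ 2))⁻¹ * u i - w i) := fun u i => by
    rw [(hΦ u).fderiv]
    simp [EuclideanSpace.inner_single_right]
  have hsc : Continuous fun u : Coord d => (√(1 + ‖u‖ ^ 2))⁻¹ :=
    Continuous.inv₀ (by fun_prop) fun u => (Real.sqrt_pos.2 (by positivity)).ne'
  have hΦc : Continuous fun u => φ (coordDist w u) :=
    (show Differentiable ℝ fun u => φ (coordDist w u) from
      fun u => (hΦ u).differentiableAt).continuous
  have hφ'c : Continuous fun u => φ' (coordDist w u) :=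
    continuous_iff_continuousAt.2 fun u => (hφ' _ (one_le_coordDist w u)).continuousAt.comp
      (f := coordDist w) hc.continuousAt
  have hΦdc : ∀ i, Continuous fun u =>
      fderiv ℝ (fun u => φ (coordDist w u)) u (basisVec i) := fun i => by
    simp only [hΦd]
    exact hφ'c.mul (((continuous_const.mul hsc).mul (by fun_prop)).sub continuous_const)
  have hφ''c : Continuous fun u => φ'' (coordDist w u) :=
    hφ''.comp_continuous hc fun u => one_le_coordDist w u
  have hYd : ∀ j, Differentiable ℝ (radialField φ' w j) := fun j u =>
    (fderiv_radialField w u j (hφ' _ (one_le_coordDist w u))).1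
  have hYe := fun j u => (fderiv_radialField w u j (hφ' _ (one_le_coordDist w u))).2
  have hYc : ∀ j, Continuous (radialField φ' w j) := fun j => (hYd j).continuous
  have hYdc : ∀ j, Continuous fun u => fderiv ℝ (radialField φ' w j) u (basisVec j) := fun j => by
    -- Opaque names let `fun_prop` use the continuity hypotheses without unfolding these factors.
    obtain ⟨I, hI⟩ : ∃ I : Coord d → ℝ, ∀ u, (√(1 + ‖u‖ ^ 2))⁻¹ = I u := ⟨_, fun _ => rfl⟩
    obtain ⟨A, hA⟩ : ∃ A : Coord d → ℝ, ∀ u, φ'' (coordDist w u) = A u := ⟨_, fun _ => rfl⟩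
    obtain ⟨B, hB⟩ : ∃ B : Coord d → ℝ, ∀ u, φ' (coordDist w u) = B u := ⟨_, fun _ => rfl⟩
    simp only [hI] at hsc
    simp only [hA] at hφ''c
    simp only [hB] at hφ'c
    simp only [hYe, hI, hA, hB]
    fun_prop
  calc ∫ u, density u * (φ (coordDist w u) * coordLaplacian F u)
      = ∫ u, ∑ i, φ (coordDist w u) * fderiv ℝ (X i) u (basisVec i) := by
        refine integral_congr_ae (.of_forall fun u => ?_)
        have := (density_pos u).ne'
        simp only [coordLaplacian, ← Finset.mul_sum]
        field_simp
        rfl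
    _ = ∑ i, ∫ u, φ (coordDist w u) * fderiv ℝ (X i) u (basisVec i) :=
        integral_finsetSum _ fun i _ =>
          (hΦc.mul (hXd i)).integrable_of_hasCompactSupport (hXdc i).mul_left
    -- First integration by parts; the compact support of `X i` removes the boundary term.
    _ = ∑ i, -∫ u, fderiv ℝ (fun u => φ (coordDist w u)) u (basisVec i) * X i u := by
        refine Finset.sum_congr rfl fun i _ => ?_
        refine integral_mul_fderiv_eq_neg_fderiv_mul_of_integrable ?_ ?_ ?_
          (fun u _ => (hΦ u).differentiableAt) (fun u _ => ((hXs i).differentiable (by simp)) u)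
        · refine Continuous.integrable_of_hasCompactSupport ?_ (hXc i).mul_left
          exact (hΦdc i).mul (hXs i).continuous
        · exact (hΦc.mul (hXd i)).integrable_of_hasCompactSupport (hXdc i).mul_left
        · exact (hΦc.mul (hXs i).continuous).integrable_of_hasCompactSupport (hXc i).mul_left
    _ = -∫ u, ∑ i, fderiv ℝ (fun u => φ (coordDist w u)) u (basisVec i) * X i u := by
        rw [Finset.sum_neg_distrib, integral_finsetSum]
        intro i _
        refine Continuous.integrable_of_hasCompactSupport ?_ (hXc i).mul_left
        exact (hΦdc i).mul (hXs i).continuous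
    -- The inverse metric is moved from the gradient of `F` to that of the radial function.
    _ = -∫ u, ∑ j, radialField φ' w j u * fderiv ℝ F u (basisVec j) := by
        congr 1
        refine integral_congr_ae (.of_forall fun u => ?_)
        simp only [hΦd, hX, radialField, ← sum_mul_metric_inv, density_eq, Finset.mul_sum,
          Finset.sum_mul]
        rw [Finset.sum_comm]
        exact Finset.sum_congr rfl fun i _ => Finset.sum_congr rfl fun j _ => by ring
    _ = ∑ j, -∫ u, radialField φ' w j u * fderiv ℝ F u (basisVec j) := by
        rw [Finset.sum_neg_distrib, integral_finsetSum]
        exact fun j _ =>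
          ((hYc j).mul (hFd j)).integrable_of_hasCompactSupport (hFdc j).mul_left
    -- Second integration by parts, now with the compact support of `F`.
    _ = ∑ j, ∫ u, fderiv ℝ (radialField φ' w j) u (basisVec j) * F u := by
        refine Finset.sum_congr rfl fun j _ => ?_
        rw [neg_eq_iff_eq_neg]
        exact integral_mul_fderiv_eq_neg_fderiv_mul_of_integrable
          (((hYdc j).mul hF.continuous).integrable_of_hasCompactSupport hFc.mul_left)
          (((hYc j).mul (hFd j)).integrable_of_hasCompactSupport (hFdc j).mul_left)
          (((hYc j).mul hF.continuous).integrable_of_hasCompactSupport hFc.mul_left)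
          (fun u _ => hYd j u) (fun u _ => (hF.differentiable (by simp)) u)
    _ = ∫ u, ∑ j, fderiv ℝ (radialField φ' w j) u (basisVec j) * F u :=
        (integral_finsetSum _ fun j _ =>
          ((hYdc j).mul hF.continuous).integrable_of_hasCompactSupport hFc.mul_left).symm
    _ = _ := by
        refine integral_congr_ae (.of_forall fun u => ?_)
        simp only [hYe]
        rw [← Finset.sum_mul, sum_deriv_radialField, density_eq]
        ring

end Green

/-! ### The fundamental solution -/

section Fundamental

variable {d : ℕ}

lemma TestFn.continuous (f : TestFn d) : Continuous f := by
  have h : (f : Hyp d → ℝ) = (f ∘ param d) ∘ (param d).symm := by funext x; simp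
  rw [h]
  exact f.smooth.continuous.comp (param d).symm.continuous

lemma TestFn.exists_bound (f : TestFn d) : ∃ C, 0 ≤ C ∧ ∀ y, |f y| ≤ C := by
  obtain ⟨C, hC⟩ := f.hasCompactSupport.exists_bound_of_continuous f.continuous
  exact ⟨C, (norm_nonneg _).trans (hC (origin d)), hC⟩

lemma TestFn.exists_height_le (f : TestFn d) : ∃ R, 1 ≤ R ∧ ∀ y, f y ≠ 0 → height y ≤ R := by
  obtain ⟨R, hR, h⟩ := Hyperbolic.exists_height_le f.hasCompactSupport
  exact ⟨R, hR, fun y hy => h y (subset_tsupport _ hy)⟩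

lemma abs_kern_mul_le {R C : ℝ} {f : Hyp d → ℝ} (hR : ∀ y, f y ≠ 0 → height y ≤ R)
    (hC : ∀ y, |f y| ≤ C) (x y : Hyp d) : |kern d 0 (coshDist x y) * f y| ≤
      C * {y | height y ≤ R}.indicator (fun y => |kern d 0 (coshDist x y)|) y := by
  by_cases h : f y = 0
  · rw [h, mul_zero, abs_zero]
    exact mul_nonneg ((abs_nonneg _).trans (hC y)) (indicator_nonneg (fun _ _ => abs_nonneg _) _)
  · rw [indicator_of_mem (by exact hR y h), abs_mul, mul_comm]
    exact mul_le_mul_of_nonneg_right (hC y) (abs_nonneg _)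

lemma measurableSet_height_le (R : ℝ) : MeasurableSet {y : Hyp d | height y ≤ R} :=
  (isCompact_height_le R).isClosed.measurableSet

lemma integrable_kern_mul (hd : d ≠ 0) (x : Hyp d) (f : TestFn d) :
    Integrable (fun y => kern d 0 (coshDist x y) * f y) (vol d) := by
  obtain ⟨C, -, hC⟩ := f.exists_bound
  obtain ⟨R, -, hR⟩ := f.exists_height_le
  refine (((integrableOn_kern hd x R).integrable_indicator
    (measurableSet_height_le R)).const_mul C).mono'
    ((measurable_kern_coshDist 0 x).mul f.continuous.measurable).aestronglyMeasurable
    (.of_forall fun y => abs_kern_mul_le hR hC x y)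

/-- Green's formula for the regularized kernel. -/
lemma integral_kern_mul_lap {δ : ℝ} (hδ : 0 < δ) (x : Hyp d) (f : TestFn d) :
    ∫ y, kern d δ (coshDist x y) * (f.lap y - d * f y) ∂vol d =
      ∫ y, approxId d δ (coshDist x y ^ 2 - 1) * f y ∂vol d := by
  obtain ⟨w, rfl⟩ := (param d).surjective x
  set F : Coord d → ℝ := f ∘ param d with hF
  have hFs : ContDiff ℝ ∞ F := f.smooth
  have hFc : HasCompactSupport F := f.hasCompactSupport.comp_homeomorph (param d)
  have hdom : ∀ c : ℝ, 1 ≤ c → 0 < c ∧ 0 < c ^ 2 - 1 + δ := fun c hc =>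
    ⟨by linarith, by nlinarith⟩
  have hG := integral_radial_mul_coordLaplacian
    (fun c hc => hasDerivAt_kern d (hdom c hc).1 (hdom c hc).2)
    (fun c hc => hasDerivAt_kernDeriv d (hdom c hc).1 (hdom c hc).2)
    (continuousOn_kernDeriv₂ d hδ) w hFs hFc
  have hc := continuous_coordDist w
  have hkc : Continuous fun u => kern d δ (coordDist w u) :=
    continuous_iff_continuousAt.2 fun u =>
      (hasDerivAt_kern d (hdom _ (one_le_coordDist w u)).1
        (hdom _ (one_le_coordDist w u)).2).continuousAt.comp (f := coordDist w) hc.continuousAt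
  have hk'c : Continuous fun u => kernDeriv d δ (coordDist w u) :=
    continuous_iff_continuousAt.2 fun u =>
      (hasDerivAt_kernDeriv d (hdom _ (one_le_coordDist w u)).1
        (hdom _ (one_le_coordDist w u)).2).continuousAt.comp (f := coordDist w) hc.continuousAt
  have hk''c : Continuous fun u => kernDeriv₂ d δ (coordDist w u) :=
    (continuousOn_kernDeriv₂ d hδ).comp_continuous hc fun u => one_le_coordDist w u
  have hdc : Continuous (density (d := d)) := contDiff_density.continuous
  have hlapc : Continuous (coordLaplacian F) := (contDiff_coordLaplacian hFs).continuous
  have hlaps : HasCompactSupport (coordLaplacian F) := hFc.mono' fun u hu => by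
    by_contra h
    exact hu (coordLaplacian_eq_zero h)
  have hFcont := hFs.continuous
  have hi1 : Integrable fun u => density u * (kern d δ (coordDist w u) * coordLaplacian F u) :=
    (hdc.mul (hkc.mul hlapc)).integrable_of_hasCompactSupport hlaps.mul_left.mul_left
  have hi2 : Integrable fun u => density u * (kern d δ (coordDist w u) * (d * F u)) :=
    (hdc.mul (hkc.mul (continuous_const.mul hFcont))).integrable_of_hasCompactSupport
      hFc.mul_left.mul_left.mul_left
  have hi3 : Integrable fun u => density u * (((coordDist w u ^ 2 - 1) *
      kernDeriv₂ d δ (coordDist w u) + d * coordDist w u * kernDeriv d δ (coordDist w u)) * F u) :=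
    (hdc.mul (((((hc.pow 2).sub continuous_const).mul hk''c).add
      ((continuous_const.mul hc).mul hk'c)).mul hFcont)).integrable_of_hasCompactSupport
      hFc.mul_left.mul_left
  have hlap : ∀ u, f.lap (param d u) = coordLaplacian F u := fun u => by
    change laplacian f (param d u) = _
    simp [laplacian, hF]
  rw [integral_vol, integral_vol]
  calc ∫ u, density u * (kern d δ (coshDist (param d w) (param d u)) *
        (f.lap (param d u) - d * f (param d u)))
      = ∫ u, (density u * (kern d δ (coordDist w u) * coordLaplacian F u) -
          density u * (kern d δ (coordDist w u) * (d * F u))) := by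
        refine integral_congr_ae (.of_forall fun u => ?_)
        simp only [coshDist_param', hlap]
        simp only [hF, Function.comp]
        ring
    _ = ∫ u, (density u * (((coordDist w u ^ 2 - 1) * kernDeriv₂ d δ (coordDist w u) +
          d * coordDist w u * kernDeriv d δ (coordDist w u)) * F u) -
          density u * (kern d δ (coordDist w u) * (d * F u))) := by
        rw [integral_sub hi1 hi2, hG, integral_sub hi3 hi2]
    _ = _ := by
        refine integral_congr_ae (.of_forall fun u => ?_)
        simp only [coshDist_param']
        rw [← kern_equation d (hdom _ (one_le_coordDist w u)).1 (hdom _ (one_le_coordDist w u)).2]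
        simp only [hF, Function.comp]
        ring

/-! ### Convergence of the approximate identity and of the regularized kernel. -/

/-- The profile `(d / v_{d-1}) (1 + r²)^{-(d+2)/2}` of the approximate identity. -/
def profile (d : ℕ) (r : ℝ) : ℝ := d / sphereArea d * (√(1 + r ^ 2) ^ (d + 2))⁻¹

lemma profile_nonneg (d : ℕ) (r : ℝ) : 0 ≤ profile d r := by
  have : 0 ≤ sphereArea d := measureReal_nonneg
  unfold profile; positivity

/-- In polar coordinates the radial integrand `d r^{d-1} (1 + r²)^{-(d+2)/2}` is the derivative of
`(r / √(1 + r²))^d`, which grows from 0 to 1. -/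
lemma integral_profile (hd : d ≠ 0) :
    Integrable (fun u : Coord d => profile d ‖u‖) ∧ ∫ u : Coord d, profile d ‖u‖ = 1 := by
  have hv := sphereArea_pos hd
  have : Nonempty (Fin d) := ⟨⟨0, Nat.pos_of_ne_zero hd⟩⟩
  have hderiv : ∀ r ∈ Ici (0 : ℝ), HasDerivAt (fun r : ℝ => (r / √(1 + r ^ 2)) ^ d)
      (d * (r ^ (d - 1) * (√(1 + r ^ 2) ^ (d + 2))⁻¹)) r := by
    intro r _
    have hpos : 0 < 1 + r ^ 2 := by positivity
    have hs := Real.sqrt_pos.2 hpos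
    have hsq : √(1 + r ^ 2) ^ 2 = 1 + r ^ 2 := Real.sq_sqrt hpos.le
    have h0 : HasDerivAt (fun x : ℝ => 1 + x ^ 2) (2 * r) r := by
      simpa using (hasDerivAt_pow 2 r).const_add 1
    refine (((hasDerivAt_id r).div (h0.sqrt hpos.ne') hs.ne').pow d).congr_deriv ?_
    obtain ⟨n, rfl⟩ := Nat.exists_eq_succ_of_ne_zero hd
    simp only [Nat.succ_eq_add_one, Nat.add_sub_cancel, id, Pi.div_apply, div_pow]
    set s := √(1 + r ^ 2)
    have hr2 : r ^ 2 = s ^ 2 - 1 := by linarith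
    have h1 : (1 * s - r * (2 * r / (2 * s))) / s ^ 2 = (s ^ 3)⁻¹ := by
      field_simp
      rw [hr2]
      ring
    rw [h1]
    have h2 : s ^ (n + 1 + 2) = s ^ n * s ^ 3 := by ring
    rw [h2]
    field_simp
  have hlim : Tendsto (fun r : ℝ => (r / √(1 + r ^ 2)) ^ d) atTop (𝓝 1) := by
    have h : Tendsto (fun r : ℝ => (√(1 + r⁻¹ ^ 2))⁻¹ ^ d) atTop (𝓝 1) := by
      have h := (tendsto_inv_atTop_zero (𝕜 := ℝ)).pow 2
      have h2 := ((h.const_add 1).sqrt.inv₀ (by simp)).pow d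
      simpa using h2
    refine h.congr' ?_
    filter_upwards [eventually_gt_atTop 0] with r hr
    congr 1
    rw [eq_div_iff (by positivity)]
    have h3 : √(1 + r ^ 2) = r * √(1 + r⁻¹ ^ 2) := by
      nth_rewrite 2 [← Real.sqrt_sq hr.le]
      rw [← Real.sqrt_mul (by positivity)]
      congr 1
      field_simp
      ring
    rw [h3]
    have : 0 < √(1 + r⁻¹ ^ 2) := by positivity
    field_simp
  have hnn : ∀ r ∈ Ioi (0 : ℝ), 0 ≤ d * (r ^ (d - 1) * (√(1 + r ^ 2) ^ (d + 2))⁻¹) := by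
    intro r hr
    have : (0 : ℝ) < r := hr
    positivity
  have hint := integrableOn_Ioi_deriv_of_nonneg' hderiv hnn hlim
  have hval := integral_Ioi_of_hasDerivAt_of_nonneg' hderiv hnn hlim
  have hfun : (fun r : ℝ => r ^ (d - 1) • profile d r) =
      fun r => (sphereArea d)⁻¹ * (d * (r ^ (d - 1) * (√(1 + r ^ 2) ^ (d + 2))⁻¹)) := by
    funext r
    rw [profile, smul_eq_mul]
    ring
  constructor
  · rw [integrable_fun_norm_addHaar volume (f := profile d), finrank_euclideanSpace,
      Fintype.card_fin, hfun]
    exact Integrable.const_mul hint _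
  · have hv' : sphereArea d = d * volume.real (Metric.ball (0 : Coord d) 1) := by
      rw [sphereArea, Measure.toSphere_real_apply_univ, finrank_euclideanSpace, Fintype.card_fin]
    rw [integral_fun_norm_addHaar volume (profile d), finrank_euclideanSpace,
      Fintype.card_fin, hfun, integral_const_mul, hval, nsmul_eq_mul, smul_eq_mul, ← mul_assoc,
      ← hv']
    simp [hd, hv.ne']

lemma approxId_scale (d : ℕ) {r : ℝ} (hr : 0 < r) (q : ℝ) :
    r ^ d * approxId d (r ^ 2) ((r * q) ^ 2) = profile d q := by
  have h : √((r * q) ^ 2 + r ^ 2) = r * √(1 + q ^ 2) := by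
    rw [show (r * q) ^ 2 + r ^ 2 = r ^ 2 * (1 + q ^ 2) by ring, Real.sqrt_mul (sq_nonneg r),
      Real.sqrt_sq hr.le]
  rw [approxId, profile, h, mul_pow, pow_add r]
  have : 0 < √(1 + q ^ 2) := Real.sqrt_pos.2 (by positivity)
  field_simp

/-- The approximate identity about `x`, rescaled to a fixed integrable profile. -/
lemma integral_approxId (x : Hyp d) : ∃ T : Hyp d → Hyp d, Continuous T ∧ T (origin d) = x ∧
    ∀ (f : TestFn d) (r : ℝ), 0 < r →
      ∫ y, approxId d (r ^ 2) (coshDist x y ^ 2 - 1) * f y ∂vol d =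
        ∫ u : Coord d, profile d ‖u‖ * (density (r • u) * f (T (param d (r • u)))) := by
  obtain ⟨T, hT, hTc, hTo, hTd⟩ := exists_lorentz x
  refine ⟨T, hTc, hTo, fun f r hr => ?_⟩
  have hm : Measurable fun y => approxId d (r ^ 2) (coshDist x y ^ 2 - 1) * f y := by
    refine Measurable.mul ?_ f.continuous.measurable
    have h1 : Measurable (approxId d (r ^ 2)) := by unfold approxId; fun_prop
    exact h1.comp (((measurable_coshDist x).pow_const 2).sub_const 1)
  conv_lhs => rw [← hT.map_eq]
  rw [integral_map hT.aemeasurable hm.aestronglyMeasurable, integral_vol]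
  have hcomp : ∀ u, density u * (approxId d (r ^ 2) (coshDist x (T (param d u)) ^ 2 - 1) *
      f (T (param d u))) = density u * (approxId d (r ^ 2) (‖u‖ ^ 2) * f (T (param d u))) := by
    intro u
    have h1 : coshDist x (T (param d u)) = √(1 + ‖u‖ ^ 2) := by
      rw [← height_param, ← coshDist_origin, ← hTd (origin d), hTo]
    rw [h1, Real.sq_sqrt (by positivity)]
    simp
  simp only [hcomp]
  -- Substituting `r • u` for `u` produces the Jacobian `r^d`, which `approxId_scale` absorbs.
  have hs := Measure.integral_comp_smul volume (fun u : Coord d =>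
    density u * (approxId d (r ^ 2) (‖u‖ ^ 2) * f (T (param d u)))) r
  rw [finrank_euclideanSpace, Fintype.card_fin, abs_of_nonneg (by positivity), smul_eq_mul,
    eq_inv_mul_iff_mul_eq₀ (by positivity)] at hs
  rw [← hs, ← integral_const_mul]
  refine integral_congr_ae (.of_forall fun u => ?_)
  simp only [norm_smul, Real.norm_of_nonneg hr.le]
  rw [← approxId_scale d hr]
  ring

/-- After rescaling, the shrinking parameter sits only in bounded continuous factors. At `r = 0` the
density is 1 and `T` sends the origin to `x`, so dominated convergence leaves `f x` times the unit
mass. -/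
lemma tendsto_integral_approxId (hd : d ≠ 0) (x : Hyp d) (f : TestFn d) :
    Tendsto (fun r : ℝ => ∫ y, approxId d (r ^ 2) (coshDist x y ^ 2 - 1) * f y ∂vol d) (𝓝[>] 0)
      (𝓝 (f x)) := by
  obtain ⟨T, hTc, hTo, hT⟩ := integral_approxId x
  obtain ⟨hpi, hp1⟩ := integral_profile hd
  obtain ⟨C, hC0, hC⟩ := f.exists_bound
  have hdc : Continuous (density (d := d)) := contDiff_density.continuous
  have hfc : Continuous fun u : Coord d => f (T (param d u)) :=
    f.continuous.comp (hTc.comp (param d).continuous)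
  have hlim : Tendsto (fun r : ℝ =>
      ∫ u : Coord d, profile d ‖u‖ * (density (r • u) * f (T (param d (r • u))))) (𝓝[>] 0)
      (𝓝 (∫ u : Coord d, profile d ‖u‖ * f x)) := by
    refine tendsto_integral_filter_of_dominated_convergence (fun u => profile d ‖u‖ * C) ?_ ?_
      (hpi.mul_const C) ?_
    · refine .of_forall fun r => hpi.aestronglyMeasurable.mul ?_
      exact ((hdc.comp (continuous_const_smul r)).mul
        (hfc.comp (continuous_const_smul r))).aestronglyMeasurable
    · refine .of_forall fun r => .of_forall fun u => ?_
      rw [norm_mul, norm_mul, Real.norm_of_nonneg (profile_nonneg d _),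
        Real.norm_of_nonneg (density_pos _).le]
      refine mul_le_mul_of_nonneg_left ?_ (profile_nonneg d _)
      exact (mul_le_of_le_one_left (norm_nonneg _) (density_le_one _)).trans (hC _)
    · refine .of_forall fun u => Tendsto.mono_left ?_ nhdsWithin_le_nhds
      have h1 : Continuous fun r : ℝ =>
          profile d ‖u‖ * (density (r • u) * f (T (param d (r • u)))) :=
        continuous_const.mul ((hdc.comp (by fun_prop : Continuous fun r : ℝ => r • u)).mul
          (hfc.comp (by fun_prop : Continuous fun r : ℝ => r • u)))
      have h2 := h1.tendsto 0
      have h3 : T (param d 0) = x := hTo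
      simpa [density_eq, h3] using h2
  rw [integral_mul_const, hp1, one_mul] at hlim
  refine hlim.congr' ?_
  filter_upwards [self_mem_nhdsWithin] with r hr
  exact (hT f r hr).symm

lemma ae_one_lt_coshDist (hd : d ≠ 0) (x : Hyp d) : ∀ᵐ y ∂vol d, 1 < coshDist x y := by
  have := nullSingletonClass_vol hd
  have h : ∀ᵐ y ∂vol d, y ≠ x := by simp [ae_iff]
  filter_upwards [h] with y hy
  exact one_lt_coshDist hy.symm

lemma tendsto_integral_kern (hd : d ≠ 0) (x : Hyp d) (f : TestFn d) :
    Tendsto (fun r : ℝ => ∫ y, kern d (r ^ 2) (coshDist x y) * f y ∂vol d) (𝓝[>] 0)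
      (𝓝 (∫ y, kern d 0 (coshDist x y) * f y ∂vol d)) := by
  have hv := sphereArea_pos hd
  have hr2 : Tendsto (fun r : ℝ => r ^ 2) (𝓝[>] 0) (𝓝[>] 0) := by
    refine tendsto_nhdsWithin_iff.2 ⟨?_, ?_⟩
    · have : Tendsto (fun r : ℝ => r ^ 2) (𝓝 0) (𝓝 (0 ^ 2)) := (continuous_pow 2).tendsto 0
      rw [zero_pow two_ne_zero] at this
      exact this.mono_left nhdsWithin_le_nhds
    · filter_upwards [self_mem_nhdsWithin] with r hr
      exact pow_pos (show (0 : ℝ) < r from hr) 2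
  refine tendsto_integral_filter_of_dominated_convergence
    (fun y => |kern d 0 (coshDist x y) * f y|) ?_ ?_ (integrable_kern_mul hd x f).abs ?_
  · exact .of_forall fun r =>
      ((measurable_kern_coshDist _ x).mul f.continuous.measurable).aestronglyMeasurable
  · refine .of_forall fun r => ?_
    filter_upwards [ae_one_lt_coshDist hd x] with y hy
    rw [Real.norm_eq_abs, abs_mul, abs_mul]
    refine mul_le_mul_of_nonneg_right ?_ (abs_nonneg _)
    rw [abs_kern hd (by linarith), abs_kern hd (by linarith)]
    have := tail_le_tail_zero d (sq_nonneg r) hy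
    gcongr
  · filter_upwards [ae_one_lt_coshDist hd x] with y hy
    exact (((tendsto_tail_zero d hy).comp hr2).neg.const_mul _).mul_const _

/-- The kernel is the fundamental solution of `Δ - d`. -/
theorem integral_kern_mul_lap_sub (hd : d ≠ 0) (x : Hyp d) (f : TestFn d) :
    ∫ y, kern d 0 (coshDist x y) * (f.lap y - d * f y) ∂vol d = f x := by
  have h1 := tendsto_integral_kern hd x (f.lap - (d : ℝ) • f)
  simp only [TestFn.sub_apply, TestFn.smul_apply] at h1
  -- With `δ = r²`, the two sides of the regularized Green formula have the two sides of the claim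
  -- as limits.
  refine tendsto_nhds_unique h1 ((tendsto_integral_approxId hd x f).congr' ?_)
  filter_upwards [self_mem_nhdsWithin] with r hr
  have hr' : (0 : ℝ) < r := hr
  exact (integral_kern_mul_lap (pow_pos hr' 2) x f).symm

end Fundamental

/-! ### Potentials of test functions and of measures -/

section Potential

variable {d : ℕ}

lemma G_ae_eq (hd : d ≠ 0) (x : Hyp d) :
    (fun y => G x y) =ᵐ[vol d] fun y => kern d 0 (coshDist x y) := by
  have := nullSingletonClass_vol hd
  have h : ∀ᵐ y ∂vol d, y ≠ x := by simp [ae_iff]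
  filter_upwards [h] with y hy
  exact G_eq_kern hd hy.symm

lemma integrable_G_mul (hd : d ≠ 0) (x : Hyp d) (f : TestFn d) :
    Integrable (fun y => G x y * f y) (vol d) := by
  refine (integrable_kern_mul hd x f).congr ?_
  filter_upwards [G_ae_eq hd x] with y hy
  rw [hy]

lemma potential_eq (hd : d ≠ 0) (f : Hyp d → ℝ) (x : Hyp d) :
    potential f x = d * ∫ y, kern d 0 (coshDist x y) * f y ∂vol d := by
  rw [potential]
  congr 1
  refine integral_congr_ae ?_
  filter_upwards [G_ae_eq hd x] with y hy
  rw [hy]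

lemma measurable_potential (hd : d ≠ 0) (f : TestFn d) : Measurable (potential f) := by
  have h : potential f = fun x => d * ∫ y, kern d 0 (coshDist x y) * f y ∂vol d :=
    funext (potential_eq hd f)
  rw [h]
  refine Measurable.const_mul ?_ _
  refine (StronglyMeasurable.integral_prod_right
    (f := fun x y => kern d 0 (coshDist x y) * f y) ?_).measurable
  refine Measurable.stronglyMeasurable ?_
  exact ((measurable_kern d 0).comp continuous_coshDist.measurable).mul
    (f.continuous.measurable.comp measurable_snd)

/-- The potential of a test function supported in a fixed ball is controlled by its supremum. -/
lemma exists_abs_potential_le (hd : d ≠ 0) {R : ℝ} (hR : 1 ≤ R) :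
    ∃ C, 0 ≤ C ∧ ∀ (f : TestFn d) (M : ℝ), (∀ y, f y ≠ 0 → height y ≤ R) → (∀ y, |f y| ≤ M) →
      ∀ x, |potential f x| ≤ C * M * (height x ^ d)⁻¹ := by
  obtain ⟨C, hC, hb⟩ := exists_setIntegral_kern_le hd hR
  refine ⟨d * C, by positivity, fun f M hf hM x => ?_⟩
  have hM0 : 0 ≤ M := (abs_nonneg _).trans (hM x)
  rw [potential_eq hd, abs_mul, abs_of_nonneg (Nat.cast_nonneg d)]
  have h1 : |∫ y, kern d 0 (coshDist x y) * f y ∂vol d| ≤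
      ∫ y, M * {y | height y ≤ R}.indicator (fun y => |kern d 0 (coshDist x y)|) y ∂vol d := by
    rw [← Real.norm_eq_abs]
    exact norm_integral_le_of_norm_le (((integrableOn_kern hd x R).integrable_indicator
      (measurableSet_height_le R)).const_mul M) (.of_forall fun y => abs_kern_mul_le hf hM x y)
  rw [integral_const_mul, integral_indicator (measurableSet_height_le R)] at h1
  calc d * |∫ y, kern d 0 (coshDist x y) * f y ∂vol d|
      ≤ d * (M * (C * (height x ^ d)⁻¹)) := by
        have := hb x
        gcongr
        exact h1.trans (by gcongr)
    _ = _ := by ring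

/-! ### Integration of potentials against `μ` and continuity of the functional. -/

variable {μ : Measure (Hyp d)} [IsFiniteMeasureOnCompacts μ]

lemma integrable_potential (hd : d ≠ 0) (hμ : DecayCondition μ) (f : TestFn d) :
    Integrable (potential f) μ := by
  obtain ⟨M, -, hM⟩ := f.exists_bound
  obtain ⟨R, hR, hf⟩ := f.exists_height_le
  obtain ⟨C, -, hC⟩ := exists_abs_potential_le hd hR
  exact ((integrable_height_inv hd hμ).const_mul (C * M)).mono'
    (measurable_potential hd f).aestronglyMeasurable (.of_forall fun x => hC f M hf hM x)

/-- Integrating the pointwise decay bound shows that the functional has order zero: on each ball the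
supremum norm of the test function controls it. -/
lemma exists_abs_integral_potential_le (hd : d ≠ 0) (hμ : DecayCondition μ) {R : ℝ} (hR : 1 ≤ R) :
    ∃ C, 0 ≤ C ∧ ∀ (f : TestFn d) (M : ℝ), (∀ y, f y ≠ 0 → height y ≤ R) → (∀ y, |f y| ≤ M) →
      |∫ x, potential f x ∂μ| ≤ C * M := by
  obtain ⟨C, hC0, hC⟩ := exists_abs_potential_le hd hR
  refine ⟨C * ∫ x, (height x ^ d)⁻¹ ∂μ, mul_nonneg hC0 (integral_nonneg fun x => ?_),
    fun f M hf hM => ?_⟩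
  · have := one_le_height x
    exact inv_nonneg.2 (pow_nonneg (by linarith) _)
  · rw [← Real.norm_eq_abs]
    refine (norm_integral_le_of_norm_le ((integrable_height_inv hd hμ).const_mul (C * M))
      (.of_forall fun x => hC f M hf hM x)).trans_eq ?_
    rw [integral_const_mul]
    ring

lemma potential_add (hd : d ≠ 0) (f g : TestFn d) (x : Hyp d) :
    potential (f + g) x = potential f x + potential g x := by
  simp only [potential, ← mul_add]
  rw [← integral_add (integrable_G_mul hd x f) (integrable_G_mul hd x g)]
  congr 1
  exact integral_congr_ae (.of_forall fun y => by simp [mul_add])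

lemma potential_smul (c : ℝ) (f : TestFn d) (x : Hyp d) :
    potential (c • f) x = c * potential f x := by
  have h : ∀ y, G x y * (c * f y) = c * (G x y * f y) := fun y => by ring
  simp only [potential, TestFn.smul_apply]
  simp only [h, integral_const_mul]
  ring

/-- A test function on `ℝ^d`, as a test function on `H^d`. -/
def TestFn.ofCoord (F : 𝓓((⊤ : TopologicalSpace.Opens (Coord d)), ℝ)) : TestFn d where
  toFun := F ∘ (param d).symm
  smooth' := by
    have h : (F ∘ (param d).symm) ∘ param d = F := by funext u; simp
    rw [h]
    exact F.contDiff
  hasCompactSupport' := F.hasCompactSupport.comp_homeomorph (param d).symm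

lemma TestFn.ofCoord_pullback (f : TestFn d) : TestFn.ofCoord f.pullback = f := by
  refine DFunLike.ext _ _ fun x => ?_
  change f (param d ((param d).symm x)) = f x
  simp

/-- The functional `f ↦ ∫ h_f dμ` on test functions on `ℝ^d`. -/
def coordFunctional (hd : d ≠ 0) (hμ : DecayCondition μ) :
    𝓓((⊤ : TopologicalSpace.Opens (Coord d)), ℝ) →L[ℝ] ℝ :=
  TestFunction.mkCLM ℝ (fun F => ∫ x, potential (TestFn.ofCoord F) x ∂μ)
    (fun F F' => by
      have h : TestFn.ofCoord (F + F') = TestFn.ofCoord F + TestFn.ofCoord F' := rfl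
      rw [← integral_add (integrable_potential hd hμ _) (integrable_potential hd hμ _), h]
      simp only [potential_add hd])
    (fun c F => by
      have h : TestFn.ofCoord (c • F) = c • TestFn.ofCoord F := rfl
      rw [h, smul_eq_mul, ← integral_const_mul]
      simp only [potential_smul])
    (fun K hK => by
      -- Continuity in the LF topology is tested on functions supported in a fixed compact `K`; `R`
      -- bounds the height there, so one constant `C` serves them all.
      obtain ⟨R, hR, hKR⟩ := Hyperbolic.exists_height_le (K.isCompact.image (param d).continuous)
      obtain ⟨C, hC0, hC⟩ := exists_abs_integral_potential_le hd hμ hR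
      let A : 𝓓_{K}(Coord d, ℝ) →ₗ[ℝ] ℝ :=
        { toFun := fun F => ∫ x, potential (TestFn.ofCoord (TestFunction.ofSupportedIn hK F)) x ∂μ
          map_add' := fun F F' => by
            have h : TestFn.ofCoord (TestFunction.ofSupportedIn hK (F + F')) =
              TestFn.ofCoord (TestFunction.ofSupportedIn hK F) +
                TestFn.ofCoord (TestFunction.ofSupportedIn hK F') := rfl
            rw [← integral_add (integrable_potential hd hμ _) (integrable_potential hd hμ _), h]
            simp only [potential_add hd]
          map_smul' := fun c F => by
            have h : TestFn.ofCoord (TestFunction.ofSupportedIn hK (c • F)) =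
              c • TestFn.ofCoord (TestFunction.ofSupportedIn hK F) := rfl
            rw [h, RingHom.id_apply, smul_eq_mul, ← integral_const_mul]
            simp only [potential_smul] }
      have hA : ∀ F, |A F| ≤
          C * ‖ContDiffMapSupportedIn.toBoundedContinuousFunctionCLM ℝ F‖ := by
        intro F
        refine hC _ _ (fun y hy => ?_) fun y => ?_
        · have hmem : (param d).symm y ∈ (K : Set (Coord d)) := by
            by_contra h
            exact hy (F.zero_on_compl h)
          exact hKR y ⟨_, hmem, by simp⟩
        · exact (ContDiffMapSupportedIn.toBoundedContinuousFunctionCLM ℝ F).norm_coe_le_norm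
            ((param d).symm y)
      refine continuous_of_continuousAt_zero A ?_
      have hB : Continuous fun F : 𝓓_{K}(Coord d, ℝ) =>
          C * ‖ContDiffMapSupportedIn.toBoundedContinuousFunctionCLM ℝ F‖ :=
        continuous_const.mul (ContinuousLinearMap.continuous _).norm
      have h0 := hB.tendsto 0
      rw [ContinuousAt, map_zero]
      rw [map_zero, norm_zero, mul_zero] at h0
      exact squeeze_zero_norm hA h0)

/-- The potential `h_μ` of a measure, as a distribution. -/
def potentialDistrib (hd : d ≠ 0) (hμ : DecayCondition μ) : Distrib d where
  toFun f := ∫ x, potential f x ∂μ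
  map_add' f g := by
    rw [← integral_add (integrable_potential hd hμ _) (integrable_potential hd hμ _)]
    exact integral_congr_ae (.of_forall fun x => potential_add hd f g x)
  map_smul' c f := by
    rw [RingHom.id_apply, smul_eq_mul, ← integral_const_mul]
    exact integral_congr_ae (.of_forall fun x => potential_smul c f x)
  cont := by
    -- The topology on test functions is induced by `pullback`, so it suffices to factor through it.
    have h : Continuous fun f : TestFn d => coordFunctional hd hμ f.pullback :=
      (coordFunctional hd hμ).continuous.comp continuous_induced_dom
    refine h.congr fun f => ?_
    change ∫ x, potential (TestFn.ofCoord f.pullback) x ∂μ = _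
    rw [TestFn.ofCoord_pullback]

/-- The potential inverts `(1/d) Δ - 1` on test functions. -/
lemma potential_lap_sub (hd : d ≠ 0) (f : TestFn d) (x : Hyp d) :
    potential ((1 / (d : ℝ)) • f.lap - f) x = f x := by
  rw [potential_eq hd, ← integral_kern_mul_lap_sub hd x f, ← integral_const_mul]
  refine integral_congr_ae (.of_forall fun y => ?_)
  have : (d : ℝ) ≠ 0 := Nat.cast_ne_zero.2 hd
  simp only [TestFn.sub_apply, TestFn.smul_apply]
  field_simp

end Potential

end Hyperbolic

end

theorem mainTheorem6 (d : ℕ) (hd : 2 ≤ d) (μ : Measure (Hyperbolic.Hyp d))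
    [IsFiniteMeasureOnCompacts μ] (hμ : Hyperbolic.DecayCondition μ) :
    (∀ f : Hyperbolic.TestFn d,
      (∀ x, Integrable (fun y => Hyperbolic.G x y * f y) (Hyperbolic.vol d)) ∧
        Integrable (Hyperbolic.potential f) μ) ∧
    ∃ hdistr : Hyperbolic.Distrib d,
      (∀ f : Hyperbolic.TestFn d, hdistr f = ∫ x, Hyperbolic.potential f x ∂μ) ∧
        Hyperbolic.IsDistribSolution hdistr μ := by
  have hd0 : d ≠ 0 := by omega
  refine ⟨fun f => ⟨fun x => Hyperbolic.integrable_G_mul hd0 x f,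
    Hyperbolic.integrable_potential hd0 hμ f⟩,
    Hyperbolic.potentialDistrib hd0 hμ, fun _ => rfl, fun f => ?_⟩
  change ∫ x, Hyperbolic.potential ((1 / (d : ℝ)) • f.lap - f : Hyperbolic.TestFn d) x ∂μ = _
  simp only [Hyperbolic.potential_lap_sub hd0 f]
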